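/- **Setting.** Let $n,m,S\ge 0$ be integers, $|\cdot|$ the Euclidean norm and $|v|_A^2=v^\top A v$. Consider the plant $$x_{k+1}=f_\theta(x_k,u_k)+w_k,\qquad f_\vartheta(x,u)=f_0(x,u)+\sum_{j=1}^S\vartheta_j f_j(x,u),$$ with state $x_k\in\mathbb R^n$, input $u_k\in\mathbb R^m$, disturbance $w_k\in\mathbb R^n$, unknown parameter $\theta\in\mathbb R^S$ and $f_j:\mathbb R^n\times\mathbb R^m\to\mathbb R^n$. Let $\varphi(x,u)\in\mathbb R^{S\times n}$ be the matrix with rows $f_1(x,u)^\top,\dots,f_S(x,u)^\top$. Let $Q\in\mathbb R^{n\times n}$, $R\in\mathbb R^{m\times m}$, $T\in\mathbb R^{n\times n}$, $P_{-1}\in\mathbb R^{S\times S}$ be symmetric positive definite and $\lambda\in(0,1)$. *Reference.* $(x_r(k),u_r(k))_{k\ge0}$ is a feasible period-$M$ sequence, $M\ge1$: $x_r(k+1)=f_\theta(x_r(k),u_r(k))$, $x_r(k+M)=x_r(k)$, $u_r(k+M)=u_r(k)$ for all $k$. It is persistently exciting (PE): there are $\alpha,\beta>0$ with $\alpha I\le\sum_{i=j}^{j+M-1}\varphi(x_r(i),u_r(i))\varphi(x_r(i),u_r(i))^\top\le\beta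 I$ for all $j\ge 0$. *MPC.* For a parameter $\vartheta$, horizon $N\ge1$ and $\mathbf u=(u_0,\dots,u_{N-1})$ put $$J_N^\vartheta(x,\mathbf u,k)=\sum_{i=0}^{N-1}|x_i-x_r(k+i)|_Q^2+|u_i-u_r(k+i)|_R^2,\qquad x_0=x,\ x_{i+1}=f_\vartheta(x_i,u_i).$$ An MPC input for $(x,k,\vartheta)$ is the first element of a global minimizer of $J_N^\vartheta(x,\cdot,k)$. Let $V_N(x,k)=\min_{\mathbf u}J_N^\theta(x,\mathbf u,k)$. *Adaptive closed loop.* The input $u_k$ is an MPC input for $(x_k,k,\hat\theta_0)$ if $k<M$ and for $(x_k,k,\hat\theta_k)$ if $k\ge M$, where, with $\varphi_k=\varphi(x_k,u_k)$ and $D_k=\lambda T+\varphi_k^\top P_{k-1}\varphi_k$, for all $k\ge0$, $$\hat\theta_{k+1}=\hat\theta_k+P_{k-1}\varphi_kD_k^{-1}\big(x_{k+1}-f_0(x_k,u_k)-\varphi_k^\top\hat\theta_k\big),\qquad P_k=\lambda^{-1}\big(I-P_{k-1}\varphi_kD_k^{-1}\varphi_k^\top\big)P_{k-1}.$$ Write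 $\tilde\theta_k=\theta-\hat\theta_k$. **Assumptions.** 1. $f_0,\dots,f_S$ are twice continuously differentiable. 2. For all $N\ge1$ and $k$, the Hessian of $\mathbf u\mapsto J_N^\theta(x_r(k),\mathbf u,k)$ is positive definite at every minimizer. 3. (Local incremental stabilizability.) For a set $Z\subseteq\mathbb R^n\times\mathbb R^m$ containing all $(x_r(k),u_r(k))$ (for example the whole space), there are $\kappa:\mathbb R^n\times\mathbb R^n\times\mathbb R^m\to\mathbb R^m$, $V_\delta:\mathbb R^n\times\mathbb R^n\times\mathbb R^m\to\mathbb R_{\ge0}$ and $c_{\delta,l},c_{\delta,u},\delta_{loc},k_{max}>0$, $\rho\in(0,1)$ such that for all $(x',u')\in Z$ the function $V_\delta(\cdot,x',u')$ is continuous and vanishes at $x'$, and for all $x$ with $V_\delta(x,x',u')\le\delta_{loc}$: $$c_{\delta,l}|x-x'|^2\le V_\delta(x,x',u')\le c_{\delta,u}|x-x'|^2,\qquad |\kappa(x,x',u')-u'|\le k_{max}|x-x'|,$$ $$V_\delta\big(f_\theta(x,\kappa(x,x',u')),f_\theta(x',u'),u''\big)\le\rho V_\delta(x,x',u')\quad\text{for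 all }u''\text{ with }(f_\theta(x',u'),u'')\in Z.$$ **Theorem.** There is $N_0\ge1$ such that for every horizon $N\ge N_0$ there are constants $c_x,c_\theta,w_{\max},\gamma_2,C>0$, $\mu\in(0,1)$ and a class-$\mathcal K$ function $V_{RPI}:[0,\infty)\to[0,\infty)$ (continuous, strictly increasing, zero at $0$) for which the following holds for every noise bound $\bar w\in(0,w_{\max}]$. Let $$\mathcal Z_{RPI}(k)=\{x-x_r(k):\ V_N(x,k)\le V_{RPI}(\bar w)\}.$$ (a) $\mathcal Z_{RPI}$ is robustly invariant for the MPC with known parameter: if $x-x_r(k)\in\mathcal Z_{RPI}(k)$, $u$ is an MPC input for $(x,k,\theta)$ and $|w|\le\bar w$, then $f_\theta(x,u)+w-x_r(k+1)\in\mathcal Z_{RPI}(k+1)$. (b) For every trajectory of the adaptive closed loop with $|w_k|\le\bar w$ for all $k$, $|x_0-x_r(0)|\le c_x$ and $|\tilde\theta_0|\le c_\theta$, the tracking error converges exponentially to $\mathcal Z_{RPI}$ and the parameter error converges exponentially to the ball of radius $\gamma_2\bar w/(1-\lambda^{1/2})$: for all $k\ge0$, $$\operatorname{dist}\big(x_k-x_r(k),\mathcal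 Z_{RPI}(k)\big)\le C\mu^k,\qquad |\tilde\theta_k|\le\frac{\gamma_2}{1-\lambda^{1/2}}\,\bar w+C\mu^k.$$ -/

import Mathlib

namespace AdaptiveMPC

/-- Column vectors with the Euclidean norm. -/
abbrev Vec (n : ℕ) : Type := EuclideanSpace ℝ (Fin n)

noncomputable section

/-! ### The plant -/

/-- The noise-free right-hand side `f(x, u) = f₀(x, u) + ∑ⱼ θⱼ fⱼ(x, u)` for the parameter `θ`. -/
def model {n m S : ℕ} (f₀ : Vec n → Vec m → Vec n) (f : Fin S → Vec n → Vec m → Vec n)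
    (θ : Vec S) (x : Vec n) (u : Vec m) : Vec n :=
  f₀ x u + ∑ j, θ j • f j x u

/-- The regressor `φ(x, u) ∈ ℝ^{S × n}`; its `j`-th row is `fⱼ(x, u)ᵀ`. -/
def regressor {n m S : ℕ} (f : Fin S → Vec n → Vec m → Vec n) (x : Vec n) (u : Vec m) :
    Matrix (Fin S) (Fin n) ℝ :=
  Matrix.of fun j i => f j x u i

/-- All `f₀, f₁, …, f_S` are twice continuously differentiable, jointly in `(x, u)`. -/
def BasisC2 {n m S : ℕ} (f₀ : Vec n → Vec m → Vec n) (f : Fin S → Vec n → Vec m → Vec n) : Prop :=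
  ContDiff ℝ 2 (fun p : Vec n × Vec m => f₀ p.1 p.2) ∧
    ∀ j, ContDiff ℝ 2 (fun p : Vec n × Vec m => f j p.1 p.2)

/-! ### Reference trajectories -/

/-- `(x, u)` is a noise-free solution of `x(k+1) = F(x(k), u(k))` with period `M ≥ 1`. -/
structure IsFeasiblePeriodic {n m : ℕ} (F : Vec n → Vec m → Vec n) (M : ℕ)
    (x : ℕ → Vec n) (u : ℕ → Vec m) : Prop where
  period_pos : 0 < M
  dynamics : ∀ k, x (k + 1) = F (x k) (u k)
  periodic_state : ∀ k, x (k + M) = x k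
  periodic_input : ∀ k, u (k + M) = u k

/-- Persistency of excitation with window `M`:
`α I ≤ ∑_{i=j}^{j+M-1} φᵢ φᵢᵀ ≤ β I` (Loewner order) for all `j`, with `α, β > 0`. -/
def IsPE {n m S : ℕ} (f : Fin S → Vec n → Vec m → Vec n) (M : ℕ)
    (x : ℕ → Vec n) (u : ℕ → Vec m) : Prop :=
  ∃ α β : ℝ, 0 < α ∧ 0 < β ∧ ∀ j : ℕ,
    ((∑ i ∈ Finset.Ico j (j + M),
        regressor f (x i) (u i) * (regressor f (x i) (u i)).transpose)
      - α • (1 : Matrix (Fin S) (Fin S) ℝ)).PosSemidef ∧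
    (β • (1 : Matrix (Fin S) (Fin S) ℝ)
      - ∑ i ∈ Finset.Ico j (j + M),
        regressor f (x i) (u i) * (regressor f (x i) (u i)).transpose).PosSemidef

/-! ### The reference-tracking MPC -/

/-- The weighted square `|v|²_Q = vᵀ Q v`. -/
def wsq {d : ℕ} (Q : Matrix (Fin d) (Fin d) ℝ) (v : Vec d) : ℝ :=
  v.ofLp ⬝ᵥ Q.mulVec v.ofLp

/-- The predicted state `x_{i|k}` for initial state `x` and input sequence `u` of length `N`
(only the values for `i ≤ N` matter). -/
def predict {n m : ℕ} (F : Vec n → Vec m → Vec n) {N : ℕ} (x : Vec n) (u : Fin N → Vec m) :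
    ℕ → Vec n
  | 0 => x
  | i + 1 => if h : i < N then F (predict F x u i) (u ⟨i, h⟩) else predict F x u i

/-- The tracking cost
`J_N(x, u, k) = ∑_{i=0}^{N-1} |x_{i|k} - x_r(k+i)|²_Q + |u_{i|k} - u_r(k+i)|²_R`,
with predictions made by `F`. -/
def cost {n m : ℕ} (F : Vec n → Vec m → Vec n) (Q : Matrix (Fin n) (Fin n) ℝ)
    (R : Matrix (Fin m) (Fin m) ℝ) (xr : ℕ → Vec n) (ur : ℕ → Vec m) (N : ℕ)
    (x : Vec n) (k : ℕ) (u : Fin N → Vec m) : ℝ :=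
  ∑ i : Fin N, (wsq Q (predict F x u i - xr (k + i)) + wsq R (u i - ur (k + i)))

/-- The optimal value `V_N(x, k)`; the costs are bounded below by `0` when `Q, R` are positive
definite. -/
def value {n m : ℕ} (F : Vec n → Vec m → Vec n) (Q : Matrix (Fin n) (Fin n) ℝ)
    (R : Matrix (Fin m) (Fin m) ℝ) (xr : ℕ → Vec n) (ur : ℕ → Vec m) (N : ℕ)
    (x : Vec n) (k : ℕ) : ℝ :=
  ⨅ u : Fin N → Vec m, cost F Q R xr ur N x k u

/-- `u₀` is the first element of some global minimizer of the tracking cost at `(x, k)`. -/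
def IsMPCInput {n m : ℕ} (F : Vec n → Vec m → Vec n) (Q : Matrix (Fin n) (Fin n) ℝ)
    (R : Matrix (Fin m) (Fin m) ℝ) (xr : ℕ → Vec n) (ur : ℕ → Vec m) (N : ℕ)
    (x : Vec n) (k : ℕ) (u₀ : Vec m) : Prop :=
  ∃ (hN : 0 < N) (u : Fin N → Vec m),
    IsMinOn (cost F Q R xr ur N x k) Set.univ u ∧ u ⟨0, hN⟩ = u₀

/-- At every point `x_r(k)` of the reference, the Hessian of the tracking cost with respect to the
input sequence is positive definite at the minimizing input sequence. -/
def PosDefHessian {n m : ℕ} (F : Vec n → Vec m → Vec n) (Q : Matrix (Fin n) (Fin n) ℝ)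
    (R : Matrix (Fin m) (Fin m) ℝ) (xr : ℕ → Vec n) (ur : ℕ → Vec m) (N : ℕ) : Prop :=
  ∀ (k : ℕ) (u : Fin N → Vec m), IsMinOn (cost F Q R xr ur N (xr k) k) Set.univ u →
    ∀ v : Fin N → Vec m, v ≠ 0 →
      0 < fderiv ℝ (fderiv ℝ (cost F Q R xr ur N (xr k) k)) u v v

/-- Local incremental stabilizability of `x⁺ = F(x, u)`, for reference pairs `(x', u')` ranging
over a set `Z`. -/
def LocallyIncrementallyStabilizable {n m : ℕ} (F : Vec n → Vec m → Vec n)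
    (Z : Set (Vec n × Vec m)) : Prop :=
  ∃ (κ : Vec n → Vec n → Vec m → Vec m) (V : Vec n → Vec n → Vec m → ℝ)
    (cl cu δ kmax ρ : ℝ),
    0 < cl ∧ 0 < cu ∧ 0 < δ ∧ 0 < kmax ∧ 0 < ρ ∧ ρ < 1 ∧
    (∀ x x' u', 0 ≤ V x x' u') ∧
    (∀ x' u', (x', u') ∈ Z → Continuous fun x => V x x' u') ∧
    (∀ x' u', (x', u') ∈ Z → V x' x' u' = 0) ∧
    ∀ x x' u', (x', u') ∈ Z → V x x' u' ≤ δ →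
      cl * ‖x - x'‖ ^ 2 ≤ V x x' u' ∧
      V x x' u' ≤ cu * ‖x - x'‖ ^ 2 ∧
      ‖κ x x' u' - u'‖ ≤ kmax * ‖x - x'‖ ∧
      ∀ u'', (F x' u', u'') ∈ Z →
        V (F x (κ x x' u')) (F x' u') u'' ≤ ρ * V x x' u'

/-! ### Recursive least squares with forgetting -/

/-- `D = λ T + φᵀ P φ`. -/
def rlsD {n S : ℕ} (lam : ℝ) (T : Matrix (Fin n) (Fin n) ℝ) (P : Matrix (Fin S) (Fin S) ℝ)
    (φ : Matrix (Fin S) (Fin n) ℝ) : Matrix (Fin n) (Fin n) ℝ :=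
  lam • T + φ.transpose * P * φ

/-- `P ↦ λ⁻¹ (I - P φ D⁻¹ φᵀ) P`. -/
def rlsP {n S : ℕ} (lam : ℝ) (T : Matrix (Fin n) (Fin n) ℝ) (P : Matrix (Fin S) (Fin S) ℝ)
    (φ : Matrix (Fin S) (Fin n) ℝ) : Matrix (Fin S) (Fin S) ℝ :=
  lam⁻¹ • ((1 - P * φ * (rlsD lam T P φ)⁻¹ * φ.transpose) * P)

/-- `θ̂ ↦ θ̂ + P φ D⁻¹ (y - φᵀ θ̂)`. -/
def rlsEstimate {n S : ℕ} (lam : ℝ) (T : Matrix (Fin n) (Fin n) ℝ)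
    (P : Matrix (Fin S) (Fin S) ℝ) (φ : Matrix (Fin S) (Fin n) ℝ) (y : Vec n) (θhat : Vec S) :
    Vec S :=
  θhat + WithLp.toLp 2
    ((P * φ * (rlsD lam T P φ)⁻¹).mulVec (y.ofLp - φ.transpose.mulVec θhat.ofLp))

/-! ### The adaptive closed loop -/

/-- The sequences `x, u, θhat, P` form a trajectory of the plant with true parameter `θ` and
disturbance `w`, controlled by the MPC with the model for `θhat 0` at times `k < M` and for
`θhat k` at times `k ≥ M`. The index of `P` is shifted: `P k` stands for `P_{k-1}`. -/
structure IsAdaptiveClosedLoop {n m S : ℕ}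
    (f₀ : Vec n → Vec m → Vec n) (f : Fin S → Vec n → Vec m → Vec n) (θ : Vec S)
    (Q : Matrix (Fin n) (Fin n) ℝ) (R : Matrix (Fin m) (Fin m) ℝ)
    (xr : ℕ → Vec n) (ur : ℕ → Vec m) (M N : ℕ)
    (lam : ℝ) (T : Matrix (Fin n) (Fin n) ℝ) (Pinit : Matrix (Fin S) (Fin S) ℝ)
    (w : ℕ → Vec n) (x : ℕ → Vec n) (u : ℕ → Vec m) (θhat : ℕ → Vec S)
    (P : ℕ → Matrix (Fin S) (Fin S) ℝ) : Prop where
  plant : ∀ k, x (k + 1) = model f₀ f θ (x k) (u k) + w k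
  control : ∀ k, IsMPCInput (model f₀ f (if k < M then θhat 0 else θhat k)) Q R xr ur N
    (x k) k (u k)
  estimate : ∀ k, θhat (k + 1) =
    rlsEstimate lam T (P k) (regressor f (x k) (u k)) (x (k + 1) - f₀ (x k) (u k)) (θhat k)
  cov_zero : P 0 = Pinit
  cov_succ : ∀ k, P (k + 1) = rlsP lam T (P k) (regressor f (x k) (u k))

/-! ### The limit sets -/

/-- Class-`𝒦` functions on `[0, ∞)`. -/
def IsClassK (σ : ℝ → ℝ) : Prop :=
  ContinuousOn σ (Set.Ici 0) ∧ StrictMonoOn σ (Set.Ici 0) ∧ σ 0 = 0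

/-- The time-`k` section of `Z_RPI`: the tracking errors `x - x_r(k)` with `V_N(x, k) ≤ v`. -/
def ZRPI {n m : ℕ} (F : Vec n → Vec m → Vec n) (Q : Matrix (Fin n) (Fin n) ℝ)
    (R : Matrix (Fin m) (Fin m) ℝ) (xr : ℕ → Vec n) (ur : ℕ → Vec m) (N : ℕ)
    (v : ℝ) (k : ℕ) : Set (Vec n) :=
  {e | ∃ x, e = x - xr k ∧ value F Q R xr ur N x k ≤ v}

/-- The family of sets `A k` is invariant for the tracking error of the MPC with prediction model
and plant `F`, under every disturbance bounded by `wbar`. -/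
def IsRobustlyInvariant {n m : ℕ} (F : Vec n → Vec m → Vec n) (Q : Matrix (Fin n) (Fin n) ℝ)
    (R : Matrix (Fin m) (Fin m) ℝ) (xr : ℕ → Vec n) (ur : ℕ → Vec m) (N : ℕ)
    (wbar : ℝ) (A : ℕ → Set (Vec n)) : Prop :=
  ∀ (k : ℕ) (x : Vec n) (u : Vec m) (w : Vec n), x - xr k ∈ A k →
    IsMPCInput F Q R xr ur N x k u → ‖w‖ ≤ wbar → F x u + w - xr (k + 1) ∈ A (k + 1)

end

end AdaptiveMPC

/-!
Two contraction estimates interlock along the closed loop: one for the optimal value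
`V = value (model f₀ f θ)` of the true model, one for the parameter error. Both are stated for
squared quantities, so that Young's inequality for the weighted squares replaces square roots.

*Contraction of the value.* Incremental stabilizability bounds the optimal cost near the reference
by a multiple `γ` of the current state cost, uniformly in the horizon
(`exists_stabilizing_sequence`). Every tail of an optimal input sequence is optimal, so the cost of
the tails decays geometrically along the horizon; for a long horizon the last prediction step can be
exchanged for two stabilizing steps at negligible cost, and the value contracts
(`exists_shifted_sequence`). This argument tolerates sequences that are optimal only up to an
excess `g`. A minimizer for a wrong parameter `θ'` is such a near-minimizer for `θ`, with `g` a
small multiple of `V` plus a multiple of `‖θ - θ'‖ ^ 2`, because the cost is Lipschitz in the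
parameter on bounded sets (`exists_seqCost_perturbation`). No regularity of the minimizer as a
function of the parameter enters. Together with the disturbance this gives
`V⁺ ≤ η V + C (‖θ - θ'‖ ^ 2 + ‖w‖ ^ 2)` with `η < 1` (`exists_value_contraction`). For `θ' = θ` the
sublevel sets at heights proportional to `wbar ^ 2` are therefore robustly invariant.

*Contraction of the parameter error.* In terms of the information matrix `Λ = P⁻¹`, recursive least
squares reads `Λ⁺ = λ Λ + φ T⁻¹ φᵀ`, and the error weighted by `Λ` contracts with factor `λ` up to
the disturbance (`wsq_error_le`). While the trajectory is close to the persistently exciting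
reference, `Λ` is bounded below uniformly in time (`exists_information_lower_bound`), so the
unweighted error is bounded by a multiple of `λ ^ k` times its initial square plus `wbar ^ 2`.

*Closing the loop.* The first contraction needs a small parameter error, the second a trajectory
near the reference at past times. A strong induction on time shows that, for small initial
errors and disturbances, both hold forever (`exists_closed_loop_bounds`). The value is then at most
`a ν ^ k + b wbar ^ 2`, while the invariant set has height `2 b wbar ^ 2`: outside that set the
transient dominates, which gives the exponential convergence of the distance.
-/

namespace AdaptiveMPC

open Filter Topology

variable {n m S : ℕ}

/-! ### Weighted squares -/

section WeightedSquare

variable {d : ℕ} {A B : Matrix (Fin d) (Fin d) ℝ}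

/-- The bilinear form `vᵀ A w` whose diagonal is `wsq A`. -/
noncomputable def wdot (A : Matrix (Fin d) (Fin d) ℝ) (v w : Vec d) : ℝ :=
  v.ofLp ⬝ᵥ A.mulVec w.ofLp

lemma wdot_comm (hA : A.PosDef) (v w : Vec d) : wdot A v w = wdot A w v := by
  have h : A.transpose = A := by simpa using hA.isHermitian.eq
  unfold wdot
  rw [Matrix.dotProduct_mulVec, dotProduct_comm, ← Matrix.mulVec_transpose, h]

lemma wsq_smul (A : Matrix (Fin d) (Fin d) ℝ) (a : ℝ) (v : Vec d) :
    wsq A (a • v) = a ^ 2 * wsq A v := by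
  simp [wsq, Matrix.mulVec_smul]
  ring

lemma wsq_zero (A : Matrix (Fin d) (Fin d) ℝ) : wsq A 0 = 0 := by
  simp [wsq]

lemma wsq_nonneg (hA : A.PosDef) (v : Vec d) : 0 ≤ wsq A v := by
  simpa [wsq] using hA.posSemidef.dotProduct_mulVec_nonneg v.ofLp

lemma wsq_pos (hA : A.PosDef) {v : Vec d} (hv : v ≠ 0) : 0 < wsq A v := by
  have : v.ofLp ≠ 0 := by simpa using hv
  simpa [wsq] using hA.dotProduct_mulVec_pos this

lemma wsq_add (hA : A.PosDef) (v w : Vec d) :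
    wsq A (v + w) = wsq A v + 2 * wdot A v w + wsq A w := by
  have h := wdot_comm hA v w
  simp only [wsq, wdot, WithLp.ofLp_add, Matrix.mulVec_add, add_dotProduct, dotProduct_add] at *
  linarith

lemma wsq_sub (hA : A.PosDef) (v w : Vec d) :
    wsq A (v - w) = wsq A v - 2 * wdot A v w + wsq A w := by
  have h := wdot_comm hA v w
  simp only [wsq, wdot, WithLp.ofLp_sub, Matrix.mulVec_sub, sub_dotProduct, dotProduct_sub] at *
  linarith

/-- Young's inequality for a weighted square. -/
lemma wsq_add_le (hA : A.PosDef) (v w : Vec d) {ε : ℝ} (hε : 0 < ε) :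
    wsq A (v + w) ≤ (1 + ε) * wsq A v + (1 + ε⁻¹) * wsq A w := by
  have h := wsq_nonneg hA (ε • v - w)
  have hlin : wdot A (ε • v) w = ε * wdot A v w := by simp [wdot]
  rw [wsq_sub hA, wsq_smul, hlin] at h
  rw [wsq_add hA]
  have h2 : 0 ≤ ε⁻¹ * (ε ^ 2 * wsq A v - 2 * (ε * wdot A v w) + wsq A w) := by positivity
  have h3 : ε⁻¹ * (ε ^ 2 * wsq A v - 2 * (ε * wdot A v w) + wsq A w)
      = ε * wsq A v - 2 * wdot A v w + ε⁻¹ * wsq A w := by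
    field_simp
  linarith

lemma continuous_wsq (A : Matrix (Fin d) (Fin d) ℝ) : Continuous (wsq A) := by
  unfold wsq
  exact Continuous.dotProduct (by fun_prop)
    (Continuous.matrix_mulVec continuous_const (by fun_prop))

/-- By compactness of the unit sphere, a positive definite form is comparable to `‖v‖ ^ 2`. -/
lemma exists_wsq_bounds (hA : A.PosDef) :
    ∃ c C : ℝ, 0 < c ∧ 0 < C ∧ ∀ v : Vec d, c * ‖v‖ ^ 2 ≤ wsq A v ∧ wsq A v ≤ C * ‖v‖ ^ 2 := by
  rcases (Metric.sphere (0 : Vec d) 1).eq_empty_or_nonempty with he | hne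
  · refine ⟨1, 1, one_pos, one_pos, fun v => ?_⟩
    have hv : v = 0 := by
      by_contra hv
      have : ‖v‖⁻¹ • v ∈ Metric.sphere (0 : Vec d) 1 := by
        simp [norm_smul, inv_mul_cancel₀ (norm_ne_zero_iff.2 hv)]
      simp [he] at this
    simp [hv, wsq_zero]
  · obtain ⟨a, ha, hmin⟩ := (isCompact_sphere (0 : Vec d) 1).exists_isMinOn hne
      (continuous_wsq A).continuousOn
    obtain ⟨b, hb, hmax⟩ := (isCompact_sphere (0 : Vec d) 1).exists_isMaxOn hne
      (continuous_wsq A).continuousOn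
    have hpos : ∀ a ∈ Metric.sphere (0 : Vec d) 1, 0 < wsq A a := fun a ha =>
      wsq_pos hA (by rintro rfl; simp at ha)
    refine ⟨wsq A a, wsq A b, hpos a ha, hpos b hb, fun v => ?_⟩
    by_cases hv : v = 0
    · simp [hv, wsq_zero]
    have hn : ‖v‖ ≠ 0 := norm_ne_zero_iff.2 hv
    have hs : ‖v‖⁻¹ • v ∈ Metric.sphere (0 : Vec d) 1 := by
      simp [norm_smul, inv_mul_cancel₀ hn]
    have h : wsq A v = wsq A (‖v‖⁻¹ • v) * ‖v‖ ^ 2 := by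
      rw [wsq_smul]; field_simp
    rw [h]
    exact ⟨mul_le_mul_of_nonneg_right (hmin hs) (sq_nonneg _),
      mul_le_mul_of_nonneg_right (hmax hs) (sq_nonneg _)⟩

end WeightedSquare

/-! ### Predictions along infinite input sequences -/

section Trajectories

variable (F : Vec n → Vec m → Vec n) (Q : Matrix (Fin n) (Fin n) ℝ)
  (R : Matrix (Fin m) (Fin m) ℝ) (xr : ℕ → Vec n) (ur : ℕ → Vec m)

/-- The solution of `x⁺ = F(x, u)` started at `x` under an infinite input sequence. -/
def traj (x : Vec n) (u : ℕ → Vec m) : ℕ → Vec n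
  | 0 => x
  | i + 1 => F (traj x u i) (u i)

/-- The `i`-th summand of the tracking cost started at `(x, k)`. -/
noncomputable def stage (x : Vec n) (k : ℕ) (u : ℕ → Vec m) (i : ℕ) : ℝ :=
  wsq Q (traj F x u i - xr (k + i)) + wsq R (u i - ur (k + i))

/-- The tracking cost over the horizon `N`, as a function of infinite input sequences. With
infinite sequences, horizons of different lengths can be compared without casts. -/
noncomputable def seqCost (N : ℕ) (x : Vec n) (k : ℕ) (u : ℕ → Vec m) : ℝ :=
  ∑ i ∈ Finset.range N, stage F Q R xr ur x k u i

/-- The sequence that follows `u` for `a` steps and then switches to `v`. -/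
def splice (a : ℕ) (u v : ℕ → Vec m) (i : ℕ) : Vec m := if i < a then u i else v (i - a)

lemma predict_eq_traj (x : Vec n) (u : ℕ → Vec m) (N i : ℕ) (hi : i ≤ N) :
    predict F x (fun j : Fin N => u j) i = traj F x u i := by
  induction i with
  | zero => rfl
  | succ i ih =>
    have h : i < N := hi
    simp [predict, traj, h, ih h.le]

lemma cost_eq_seqCost (N : ℕ) (x : Vec n) (k : ℕ) (u : ℕ → Vec m) :
    cost F Q R xr ur N x k (fun j : Fin N => u j) = seqCost F Q R xr ur N x k u := by
  rw [cost, seqCost, Finset.sum_range]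
  refine Finset.sum_congr rfl fun i _ => ?_
  rw [predict_eq_traj F x u N i i.2.le, stage]

lemma exists_seq_extension {N : ℕ} (u : Fin N → Vec m) :
    ∃ v : ℕ → Vec m, u = fun j : Fin N => v j :=
  ⟨fun i => if h : i < N then u ⟨i, h⟩ else 0, by ext j; simp⟩

lemma traj_congr {x : Vec n} {u v : ℕ → Vec m} {i : ℕ} (h : ∀ j < i, u j = v j) :
    traj F x u i = traj F x v i := by
  induction i with
  | zero => rfl
  | succ i ih =>
    rw [traj, traj, ih fun j hj => h j (by omega), h i (by omega)]

lemma traj_add (x : Vec n) (u : ℕ → Vec m) (a i : ℕ) :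
    traj F x u (a + i) = traj F (traj F x u a) (fun j => u (a + j)) i := by
  induction i with
  | zero => rfl
  | succ i ih => rw [← add_assoc, traj, traj, ih]

lemma stage_add (x : Vec n) (k : ℕ) (u : ℕ → Vec m) (a i : ℕ) :
    stage F Q R xr ur x k u (a + i) =
      stage F Q R xr ur (traj F x u a) (k + a) (fun j => u (a + j)) i := by
  rw [stage, stage, traj_add, add_assoc]

lemma seqCost_succ (N : ℕ) (x : Vec n) (k : ℕ) (u : ℕ → Vec m) :
    seqCost F Q R xr ur (N + 1) x k u =
      seqCost F Q R xr ur N x k u + stage F Q R xr ur x k u N :=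
  Finset.sum_range_succ _ _

lemma seqCost_add (x : Vec n) (k : ℕ) (u : ℕ → Vec m) (a b : ℕ) :
    seqCost F Q R xr ur (a + b) x k u = seqCost F Q R xr ur a x k u +
      seqCost F Q R xr ur b (traj F x u a) (k + a) (fun j => u (a + j)) := by
  rw [seqCost, Finset.sum_range_add]
  simp only [stage_add]
  rfl

lemma seqCost_congr {x : Vec n} {k : ℕ} {u v : ℕ → Vec m} {N : ℕ} (h : ∀ j < N, u j = v j) :
    seqCost F Q R xr ur N x k u = seqCost F Q R xr ur N x k v := by
  refine Finset.sum_congr rfl fun i hi => ?_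
  have hi' : i < N := by simpa using hi
  rw [stage, stage, traj_congr F fun j hj => h j (by omega), h i hi']

lemma seqCost_splice (x : Vec n) (k : ℕ) (u v : ℕ → Vec m) (a b : ℕ) :
    seqCost F Q R xr ur (a + b) x k (splice a u v) = seqCost F Q R xr ur a x k u +
      seqCost F Q R xr ur b (traj F x u a) (k + a) v := by
  have h : ∀ j < a, splice a u v j = u j := fun j hj => by simp [splice, hj]
  rw [seqCost_add, seqCost_congr F Q R xr ur h, traj_congr F h]
  congr 2
  ext j
  simp [splice]

variable {Q R}

lemma stage_nonneg (hQ : Q.PosDef) (hR : R.PosDef) (x : Vec n) (k : ℕ) (u : ℕ → Vec m) (i : ℕ) :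
    0 ≤ stage F Q R xr ur x k u i :=
  add_nonneg (wsq_nonneg hQ _) (wsq_nonneg hR _)

lemma seqCost_nonneg (hQ : Q.PosDef) (hR : R.PosDef) (N : ℕ) (x : Vec n) (k : ℕ)
    (u : ℕ → Vec m) : 0 ≤ seqCost F Q R xr ur N x k u :=
  Finset.sum_nonneg fun _ _ => stage_nonneg F xr ur hQ hR _ _ _ _

lemma stage_le_seqCost (hQ : Q.PosDef) (hR : R.PosDef) {N i : ℕ} (hi : i < N) (x : Vec n) (k : ℕ)
    (u : ℕ → Vec m) : stage F Q R xr ur x k u i ≤ seqCost F Q R xr ur N x k u :=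
  Finset.single_le_sum (f := stage F Q R xr ur x k u)
    (fun _ _ => stage_nonneg F xr ur hQ hR _ _ _ _) (Finset.mem_range.2 hi)

lemma wsq_state_le_seqCost (hQ : Q.PosDef) (hR : R.PosDef) {N i : ℕ} (hi : i < N) (x : Vec n)
    (k : ℕ) (u : ℕ → Vec m) :
    wsq Q (traj F x u i - xr (k + i)) ≤ seqCost F Q R xr ur N x k u :=
  (le_add_of_nonneg_right (wsq_nonneg hR _)).trans (stage_le_seqCost F xr ur hQ hR hi x k u)

lemma wsq_input_le_seqCost (hQ : Q.PosDef) (hR : R.PosDef) {N i : ℕ} (hi : i < N) (x : Vec n)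
    (k : ℕ) (u : ℕ → Vec m) : wsq R (u i - ur (k + i)) ≤ seqCost F Q R xr ur N x k u :=
  (le_add_of_nonneg_left (wsq_nonneg hQ _)).trans (stage_le_seqCost F xr ur hQ hR hi x k u)

lemma value_le_seqCost (hQ : Q.PosDef) (hR : R.PosDef) (N : ℕ) (x : Vec n) (k : ℕ)
    (u : ℕ → Vec m) : value F Q R xr ur N x k ≤ seqCost F Q R xr ur N x k u := by
  rw [← cost_eq_seqCost]
  refine ciInf_le ⟨0, ?_⟩ _
  rintro _ ⟨v, rfl⟩
  obtain ⟨v, rfl⟩ := exists_seq_extension v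
  simpa only [cost_eq_seqCost] using seqCost_nonneg F xr ur hQ hR N x k v

lemma exists_seqCost_lt_of_value_lt {N : ℕ} {x : Vec n} {k : ℕ} {c : ℝ}
    (h : value F Q R xr ur N x k < c) : ∃ u, seqCost F Q R xr ur N x k u < c := by
  obtain ⟨v, hv⟩ := exists_lt_of_ciInf_lt h
  obtain ⟨v, rfl⟩ := exists_seq_extension v
  exact ⟨v, by rwa [cost_eq_seqCost] at hv⟩

lemma le_value {N : ℕ} {x : Vec n} {k : ℕ} {c : ℝ}
    (h : ∀ u, c ≤ seqCost F Q R xr ur N x k u) : c ≤ value F Q R xr ur N x k := by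
  refine le_ciInf fun v => ?_
  obtain ⟨v, rfl⟩ := exists_seq_extension v
  rw [cost_eq_seqCost]
  exact h v

lemma value_nonneg (hQ : Q.PosDef) (hR : R.PosDef) (N : ℕ) (x : Vec n) (k : ℕ) :
    0 ≤ value F Q R xr ur N x k :=
  le_value F xr ur fun u => seqCost_nonneg F xr ur hQ hR N x k u

lemma wsq_le_value (hQ : Q.PosDef) (hR : R.PosDef) {N : ℕ} (hN : 0 < N) (x : Vec n) (k : ℕ) :
    wsq Q (x - xr k) ≤ value F Q R xr ur N x k :=
  le_value F xr ur fun u => wsq_state_le_seqCost F xr ur hQ hR hN x k u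

variable {F xr ur} in
lemma IsMPCInput.exists_seq {N : ℕ} {x : Vec n} {k : ℕ} {u₀ : Vec m}
    (h : IsMPCInput F Q R xr ur N x k u₀) :
    ∃ u : ℕ → Vec m, u 0 = u₀ ∧
      ∀ v, seqCost F Q R xr ur N x k u ≤ seqCost F Q R xr ur N x k v := by
  obtain ⟨hN, u, hmin, hu⟩ := h
  obtain ⟨u, rfl⟩ := exists_seq_extension u
  refine ⟨u, hu, fun v => ?_⟩
  simpa only [cost_eq_seqCost] using
    isMinOn_iff.1 hmin (fun j : Fin N => v j) (Set.mem_univ _)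

end Trajectories

/-! ### Periodic references -/

section Reference

variable {F : Vec n → Vec m → Vec n} {M : ℕ} {xr : ℕ → Vec n} {ur : ℕ → Vec m}

lemma IsFeasiblePeriodic.eq_mod (href : IsFeasiblePeriodic F M xr ur) (k : ℕ) :
    xr k = xr (k % M) ∧ ur k = ur (k % M) :=
  ⟨(Function.Periodic.map_mod_nat href.periodic_state k).symm,
    (Function.Periodic.map_mod_nat href.periodic_input k).symm⟩

/-- A periodic reference has finitely many points, so pointwise radii can be made uniform. -/
lemma IsFeasiblePeriodic.exists_uniform_radius (href : IsFeasiblePeriodic F M xr ur)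
    {p : Vec n → Vec m → ℝ → Prop} (hp : ∀ k, ∃ r > 0, p (xr k) (ur k) r)
    (hmono : ∀ x u r s, 0 < s → s ≤ r → p x u r → p x u s) :
    ∃ r > 0, ∀ k, p (xr k) (ur k) r := by
  choose r hr hp using hp
  obtain ⟨j, -, hj⟩ := (Finset.range M).exists_min_image r
    ⟨0, Finset.mem_range.2 href.period_pos⟩
  refine ⟨r j, hr j, fun k => ?_⟩
  rw [(href.eq_mod k).1, (href.eq_mod k).2]
  exact hmono _ _ _ _ (hr j) (hj _ (Finset.mem_range.2 (Nat.mod_lt _ href.period_pos))) (hp _)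

lemma IsFeasiblePeriodic.exists_bound (href : IsFeasiblePeriodic F M xr ur) :
    ∃ r > 0, ∀ k, ‖xr k‖ ≤ r ∧ ‖ur k‖ ≤ r := by
  obtain ⟨j, -, hj⟩ := (Finset.range M).exists_max_image (fun k => max ‖xr k‖ ‖ur k‖)
    ⟨0, Finset.mem_range.2 href.period_pos⟩
  refine ⟨max ‖xr j‖ ‖ur j‖ + 1, by positivity, fun k => ?_⟩
  rw [(href.eq_mod k).1, (href.eq_mod k).2]
  have := hj _ (Finset.mem_range.2 (Nat.mod_lt k href.period_pos))
  exact ⟨by linarith [le_max_left ‖xr (k % M)‖ ‖ur (k % M)‖],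
    by linarith [le_max_right ‖xr (k % M)‖ ‖ur (k % M)‖]⟩

end Reference

/-! ### Stabilizing input sequences and decrease of the cost -/

section Descent

variable {F : Vec n → Vec m → Vec n} {Q : Matrix (Fin n) (Fin n) ℝ}
  {R : Matrix (Fin m) (Fin m) ℝ} {M : ℕ} {xr : ℕ → Vec n} {ur : ℕ → Vec m}

/-- Closed-loop states of the feedback `κ` along the reference, started at `(x, k)`. -/
def feedbackState (F : Vec n → Vec m → Vec n) (κ : Vec n → Vec n → Vec m → Vec m)
    (xr : ℕ → Vec n) (ur : ℕ → Vec m) (k : ℕ) (x : Vec n) : ℕ → Vec n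
  | 0 => x
  | i + 1 => F (feedbackState F κ xr ur k x i)
      (κ (feedbackState F κ xr ur k x i) (xr (k + i)) (ur (k + i)))

/-- Near the reference, the optimal cost is at most a multiple of the current state cost,
uniformly in the horizon: the stabilizing feedback makes the stage costs decay geometrically. -/
lemma exists_stabilizing_sequence (hQ : Q.PosDef) (hR : R.PosDef)
    {Z : Set (Vec n × Vec m)} (hstab : LocallyIncrementallyStabilizable F Z)
    (href : IsFeasiblePeriodic F M xr ur) (hZ : ∀ k, (xr k, ur k) ∈ Z) :
    ∃ ε γ : ℝ, 0 < ε ∧ 1 < γ ∧ ∀ K k x, ‖x - xr k‖ ≤ ε →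
      ∃ u, seqCost F Q R xr ur K x k u ≤ γ * wsq Q (x - xr k) := by
  obtain ⟨κ, V, cl, cu, δ, kmax, ρ, hcl, hcu, hδ, hkmax, hρ0, hρ1, -, hVcont, hVzero, hV⟩ := hstab
  obtain ⟨ε, hε, hεV⟩ := href.exists_uniform_radius
    (p := fun x' u' r => ∀ x, ‖x - x'‖ ≤ r → V x x' u' ≤ δ) (fun k => by
      have hnear : ∀ᶠ x in 𝓝 (xr k), V x (xr k) (ur k) < δ :=
        (hVcont _ _ (hZ k)).continuousAt.eventually_lt continuousAt_const
          (by rw [hVzero _ _ (hZ k)]; exact hδ)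
      obtain ⟨r, hr, h⟩ := Metric.eventually_nhds_iff.1 hnear
      refine ⟨r / 2, half_pos hr, fun x hx => (h ?_).le⟩
      rw [dist_eq_norm]
      linarith)
    (fun x' u' r s _ hsr h x hx => h x (hx.trans hsr))
  obtain ⟨cQ, CQ, hcQ, hCQ, hQb⟩ := exists_wsq_bounds hQ
  obtain ⟨cR, CR, hcR, hCR, hRb⟩ := exists_wsq_bounds hR
  set A : ℝ := (CQ + CR * kmax ^ 2) / cl * (cu / cQ) with hA
  have hA0 : 0 < A := by positivity
  refine ⟨ε, A * (1 - ρ)⁻¹ + 1, hε, ?_, fun K k x hx => ?_⟩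
  · have : 0 < (1 - ρ)⁻¹ := inv_pos.2 (by linarith)
    nlinarith
  set y := feedbackState F κ xr ur k x with hy
  have hVy : ∀ i, V (y i) (xr (k + i)) (ur (k + i)) ≤ δ ∧
      V (y i) (xr (k + i)) (ur (k + i)) ≤ ρ ^ i * V x (xr k) (ur k) := by
    intro i
    induction i with
    | zero => exact ⟨hεV k x hx, by simp [hy, feedbackState]⟩
    | succ i ih =>
      have hmem : (F (xr (k + i)) (ur (k + i)), ur (k + i + 1)) ∈ Z := by
        rw [← href.dynamics]; exact hZ _
      have h := (hV _ _ _ (hZ (k + i)) ih.1).2.2.2 _ hmem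
      rw [← href.dynamics] at h
      have h' : V (y (i + 1)) (xr (k + (i + 1))) (ur (k + (i + 1))) ≤
          ρ * V (y i) (xr (k + i)) (ur (k + i)) := h
      refine ⟨h'.trans ?_, h'.trans ?_⟩
      · nlinarith [ih.1]
      · rw [pow_succ' ρ i, mul_assoc]
        exact mul_le_mul_of_nonneg_left ih.2 hρ0.le
  refine ⟨fun i => κ (y i) (xr (k + i)) (ur (k + i)), ?_⟩
  have htraj : ∀ i, traj F x (fun i => κ (y i) (xr (k + i)) (ur (k + i))) i = y i := by
    intro i
    induction i with
    | zero => rfl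
    | succ i ih => rw [traj, ih]; rfl
  have hV0 : V x (xr k) (ur k) ≤ cu / cQ * wsq Q (x - xr k) := by
    have h1 := (hV _ _ _ (hZ k) (hεV k x hx)).2.1
    have h2 : ‖x - xr k‖ ^ 2 ≤ cQ⁻¹ * wsq Q (x - xr k) := by
      rw [le_inv_mul_iff₀ hcQ]; exact (hQb _).1
    calc V x (xr k) (ur k) ≤ cu * ‖x - xr k‖ ^ 2 := h1
      _ ≤ cu * (cQ⁻¹ * wsq Q (x - xr k)) := by gcongr
      _ = _ := by ring
  have hstage : ∀ i, stage F Q R xr ur x k (fun i => κ (y i) (xr (k + i)) (ur (k + i))) i ≤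
      A * wsq Q (x - xr k) * ρ ^ i := by
    intro i
    obtain ⟨h1, -, h3, -⟩ := hV _ _ _ (hZ (k + i)) (hVy i).1
    have h4 : ‖y i - xr (k + i)‖ ^ 2 ≤ cl⁻¹ * (ρ ^ i * (cu / cQ * wsq Q (x - xr k))) := by
      rw [le_inv_mul_iff₀ hcl]
      refine h1.trans ((hVy i).2.trans ?_)
      gcongr
    have h5 : ‖κ (y i) (xr (k + i)) (ur (k + i)) - ur (k + i)‖ ^ 2 ≤
        kmax ^ 2 * ‖y i - xr (k + i)‖ ^ 2 := by
      rw [← mul_pow]; gcongr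
    rw [stage, htraj]
    calc wsq Q (y i - xr (k + i)) + wsq R (κ (y i) (xr (k + i)) (ur (k + i)) - ur (k + i))
        ≤ CQ * ‖y i - xr (k + i)‖ ^ 2 + CR * (kmax ^ 2 * ‖y i - xr (k + i)‖ ^ 2) := by
          refine add_le_add (hQb _).2 ((hRb _).2.trans ?_)
          gcongr
      _ = (CQ + CR * kmax ^ 2) * ‖y i - xr (k + i)‖ ^ 2 := by ring
      _ ≤ (CQ + CR * kmax ^ 2) * (cl⁻¹ * (ρ ^ i * (cu / cQ * wsq Q (x - xr k)))) := by gcongr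
      _ = A * wsq Q (x - xr k) * ρ ^ i := by rw [hA]; ring
  have hw := wsq_nonneg hQ (x - xr k)
  calc seqCost F Q R xr ur K x k (fun i => κ (y i) (xr (k + i)) (ur (k + i)))
      ≤ ∑ i ∈ Finset.range K, A * wsq Q (x - xr k) * ρ ^ i :=
        Finset.sum_le_sum fun i _ => hstage i
    _ = A * wsq Q (x - xr k) * ∑ i ∈ Finset.range K, ρ ^ i := by rw [Finset.mul_sum]
    _ ≤ A * wsq Q (x - xr k) * (1 - ρ)⁻¹ := by
        gcongr
        rw [← tsum_geometric_of_lt_one hρ0.le hρ1]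
        exact (summable_geometric_of_lt_one hρ0.le hρ1).sum_le_tsum _ fun i _ => by positivity
    _ ≤ (A * (1 - ρ)⁻¹ + 1) * wsq Q (x - xr k) := by nlinarith

/-- Relaxed dynamic programming. If an input sequence is optimal up to `g`, so are all its tails;
hence the cost of the tail decays geometrically along the horizon, and the last prediction step
can be replaced by two stabilizing steps at a price that vanishes for long horizons. -/
lemma exists_shifted_sequence (hQ : Q.PosDef) (hR : R.PosDef) {ε γ c g : ℝ} (hγ : 1 < γ)
    (hcand : ∀ K k x, ‖x - xr k‖ ≤ ε →
      ∃ u, seqCost F Q R xr ur K x k u ≤ γ * wsq Q (x - xr k))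
    (hc : ∀ v : Vec n, wsq Q v ≤ c → ‖v‖ ≤ ε) {p k : ℕ} {x : Vec n} {u : ℕ → Vec m} (hg : 0 ≤ g)
    (hle : seqCost F Q R xr ur (p + 2) x k u ≤ c)
    (hnear : ∀ v, seqCost F Q R xr ur (p + 2) x k u ≤ seqCost F Q R xr ur (p + 2) x k v + g) :
    ∃ v, seqCost F Q R xr ur (p + 2) (F x (u 0)) (k + 1) v ≤
      (1 - γ⁻¹ + γ * (1 - γ⁻¹) ^ (p + 1)) * seqCost F Q R xr ur (p + 2) x k u
        + (γ⁻¹ + γ) * g := by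
  set J := fun N => seqCost F Q R xr ur N x k u with hJ
  set e := fun i => wsq Q (traj F x u i - xr (k + i)) with he
  have hγ0 : 0 < γ := by linarith
  have hq : 0 ≤ 1 - γ⁻¹ := sub_nonneg.2 (inv_le_one_of_one_le₀ hγ.le)
  have hsmall : ∀ i < p + 2, ‖traj F x u i - xr (k + i)‖ ≤ ε := fun i hi =>
    hc _ ((wsq_state_le_seqCost F xr ur hQ hR hi x k u).trans hle)
  have hestage : ∀ i, e i ≤ stage F Q R xr ur x k u i := fun i =>
    le_add_of_nonneg_right (wsq_nonneg hR _)
  have htail : ∀ i < p + 2, J (p + 2) - J i ≤ γ * e i + g := by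
    intro i hi
    obtain ⟨v, hv⟩ := hcand (p + 2 - i) (k + i) _ (hsmall i hi)
    have h := hnear (splice i u v)
    have hsp := seqCost_splice F Q R xr ur x k u v i (p + 2 - i)
    rw [Nat.add_sub_cancel' hi.le] at hsp
    simp only [hJ, he]
    linarith
  have hstep : ∀ i < p + 2, J (p + 2) - J (i + 1) ≤ (1 - γ⁻¹) * (J (p + 2) - J i) + γ⁻¹ * g := by
    intro i hi
    have h1 := htail i hi
    have h2 : J (i + 1) = J i + stage F Q R xr ur x k u i := seqCost_succ _ _ _ _ _ _ _ _ _
    have h3 := hestage i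
    have h4 : γ⁻¹ * (J (p + 2) - J i) ≤ e i + γ⁻¹ * g := by
      have := mul_le_mul_of_nonneg_left h1 (inv_pos.2 hγ0).le
      rwa [mul_add, inv_mul_cancel_left₀ hγ0.ne'] at this
    linarith
  have hdecay : ∀ i ≤ p + 1, J (p + 2) - J i ≤ (1 - γ⁻¹) ^ i * J (p + 2) + g := by
    intro i
    induction i with
    | zero =>
      intro _
      have : J 0 = 0 := by simp [hJ, seqCost]
      rw [this]; simpa using hg
    | succ i ih =>
      intro hi
      have h1 := hstep i (by omega)
      have h2 := mul_le_mul_of_nonneg_left (ih (by omega)) hq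
      rw [pow_succ' (1 - γ⁻¹) i]
      linarith
  obtain ⟨v, hv⟩ := hcand 2 (k + (p + 1)) _ (hsmall (p + 1) (by omega))
  refine ⟨fun j => splice (p + 1) u v (1 + j), ?_⟩
  have hsp := seqCost_splice F Q R xr ur x k u v (p + 1) 2
  rw [show p + 1 + 2 = 1 + (p + 2) by ring, seqCost_add] at hsp
  have h0 : splice (p + 1) u v 0 = u 0 := by simp [splice]
  have htr : traj F x (splice (p + 1) u v) 1 = F x (u 0) := by
    rw [traj, h0]; rfl
  have hcost1 : seqCost F Q R xr ur 1 x k (splice (p + 1) u v) = J 1 :=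
    seqCost_congr F Q R xr ur fun j hj => by
      obtain rfl : j = 0 := by omega
      exact h0
  rw [htr, hcost1] at hsp
  have h1 := hstep 0 (by omega)
  have hJ0 : J 0 = 0 := by simp [hJ, seqCost]
  rw [hJ0, sub_zero, zero_add] at h1
  have h2 := hdecay (p + 1) le_rfl
  have h3 : J (p + 2) = J (p + 1) + stage F Q R xr ur x k u (p + 1) :=
    seqCost_succ _ _ _ _ _ _ _ _ _
  have h4 := hestage (p + 1)
  have h5 : 0 ≤ e (p + 1) := wsq_nonneg hQ _
  have h6 : γ * e (p + 1) ≤ γ * ((1 - γ⁻¹) ^ (p + 1) * J (p + 2) + g) := by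
    gcongr; linarith
  change _ ≤ _ * J (p + 2) + _
  have h7 : J (p + 1) = seqCost F Q R xr ur (p + 1) x k u := rfl
  linarith

end Descent

/-! ### Sensitivity to the parameter and to the state -/

section Sensitivity

variable {f₀ : Vec n → Vec m → Vec n} {f : Fin S → Vec n → Vec m → Vec n}

lemma contDiff_predict (hC2 : BasisC2 f₀ f) (N i : ℕ) :
    ContDiff ℝ 1 (fun z : Vec S × Vec n × (Fin N → Vec m) =>
      predict (model f₀ f z.1) z.2.1 z.2.2 i) := by
  have h0 := hC2.1.of_le (one_le_two)
  have hf := fun j => (hC2.2 j).of_le (one_le_two)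
  induction i with
  | zero => exact contDiff_fst.comp contDiff_snd
  | succ i ih =>
    by_cases h : i < N
    · simp only [predict, h, dite_true, model]
      have hu : ContDiff ℝ 1 fun z : Vec S × Vec n × (Fin N → Vec m) => z.2.2 ⟨i, h⟩ := by fun_prop
      refine (h0.comp (ih.prodMk hu)).add (ContDiff.sum fun j _ => ?_)
      have hθ : ContDiff ℝ 1 fun z : Vec S × Vec n × (Fin N → Vec m) => z.1 j := by fun_prop
      exact hθ.smul ((hf j).comp (ih.prodMk hu))
    · simpa only [predict, h, dite_false] using ih

/-- On bounded sets the predictions depend Lipschitz continuously on the parameter and on the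
initial state. -/
lemma exists_traj_lipschitz (hC2 : BasisC2 f₀ f) (N : ℕ) (r : ℝ) :
    ∃ K : ℝ, 0 ≤ K ∧ ∀ (θ₁ θ₂ : Vec S) (x₁ x₂ : Vec n) (u : ℕ → Vec m),
      ‖θ₁‖ ≤ r → ‖θ₂‖ ≤ r → ‖x₁‖ ≤ r → ‖x₂‖ ≤ r → (∀ i < N, ‖u i‖ ≤ r) → ∀ i < N,
      ‖traj (model f₀ f θ₁) x₁ u i - traj (model f₀ f θ₂) x₂ u i‖ ^ 2 ≤
        K * (‖x₁ - x₂‖ ^ 2 + ‖θ₁ - θ₂‖ ^ 2) := by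
  have hcd : ContDiff ℝ 1 (fun (z : Vec S × Vec n × (Fin N → Vec m)) (i : Fin N) =>
      predict (model f₀ f z.1) z.2.1 z.2.2 i) :=
    contDiff_pi.2 fun i => contDiff_predict hC2 N i
  obtain ⟨K, hK⟩ := hcd.contDiffOn.exists_lipschitzOnWith one_ne_zero
    (convex_closedBall (0 : Vec S × Vec n × (Fin N → Vec m)) r) (isCompact_closedBall _ _)
  refine ⟨(K : ℝ) ^ 2, by positivity, fun θ₁ θ₂ x₁ x₂ u hθ₁ hθ₂ hx₁ hx₂ hu i hi => ?_⟩
  have hr : 0 ≤ r := (norm_nonneg _).trans hx₁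
  have hU : ‖fun j : Fin N => u j‖ ≤ r := (pi_norm_le_iff_of_nonneg hr).2 fun j => hu j j.2
  have hmem : ∀ (θ' : Vec S) (x : Vec n), ‖θ'‖ ≤ r → ‖x‖ ≤ r →
      (θ', x, fun j : Fin N => u j) ∈
        Metric.closedBall (0 : Vec S × Vec n × (Fin N → Vec m)) r := by
    intro θ' x h1 h2
    rw [mem_closedBall_zero_iff]
    exact max_le h1 (max_le h2 hU)
  have h := hK.norm_sub_le (hmem θ₁ x₁ hθ₁ hx₁) (hmem θ₂ x₂ hθ₂ hx₂)
  have h' := (norm_le_pi_norm _ (⟨i, hi⟩ : Fin N)).trans h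
  simp only [Pi.sub_apply, predict_eq_traj _ _ _ N i hi.le] at h'
  have hmax : ‖(θ₁, x₁, fun j : Fin N => u j) - (θ₂, x₂, fun j : Fin N => u j)‖ =
      max ‖θ₁ - θ₂‖ ‖x₁ - x₂‖ := by
    simp [Prod.norm_def]
  rw [hmax] at h'
  have h2 : max ‖θ₁ - θ₂‖ ‖x₁ - x₂‖ ^ 2 ≤ ‖x₁ - x₂‖ ^ 2 + ‖θ₁ - θ₂‖ ^ 2 := by
    rcases max_choice ‖θ₁ - θ₂‖ ‖x₁ - x₂‖ with h | h <;> rw [h] <;>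
      nlinarith [sq_nonneg ‖x₁ - x₂‖, sq_nonneg ‖θ₁ - θ₂‖]
  calc _ ≤ ((K : ℝ) * max ‖θ₁ - θ₂‖ ‖x₁ - x₂‖) ^ 2 := by gcongr
    _ = (K : ℝ) ^ 2 * max ‖θ₁ - θ₂‖ ‖x₁ - x₂‖ ^ 2 := by ring
    _ ≤ _ := by gcongr

/-- Changing the parameter and the initial state changes the cost of an input sequence of bounded
cost by a factor arbitrarily close to `1`, up to a multiple of the squared changes. -/
lemma exists_seqCost_perturbation (hC2 : BasisC2 f₀ f) {Q : Matrix (Fin n) (Fin n) ℝ}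
    {R : Matrix (Fin m) (Fin m) ℝ} (hQ : Q.PosDef) (hR : R.PosDef) {xr : ℕ → Vec n}
    {ur : ℕ → Vec m} {ru : ℝ} (hur : ∀ k, ‖ur k‖ ≤ ru) (N : ℕ) (r B : ℝ) :
    ∃ C : ℝ, 0 < C ∧ ∀ (ε : ℝ) (k : ℕ) (θ₁ θ₂ : Vec S) (x₁ x₂ : Vec n) (u : ℕ → Vec m), 0 < ε →
      ‖θ₁‖ ≤ r → ‖θ₂‖ ≤ r → ‖x₁‖ ≤ r → ‖x₂‖ ≤ r →
      seqCost (model f₀ f θ₁) Q R xr ur N x₁ k u ≤ B →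
      seqCost (model f₀ f θ₂) Q R xr ur N x₂ k u ≤
        (1 + ε) * seqCost (model f₀ f θ₁) Q R xr ur N x₁ k u
          + (1 + ε⁻¹) * (C * (‖x₁ - x₂‖ ^ 2 + ‖θ₁ - θ₂‖ ^ 2)) := by
  obtain ⟨cQ, CQ, hcQ, hCQ, hQb⟩ := exists_wsq_bounds hQ
  obtain ⟨cR, CR, hcR, hCR, hRb⟩ := exists_wsq_bounds hR
  obtain ⟨K, hK0, hK⟩ := exists_traj_lipschitz hC2 N (max r (√(B / cR) + ru))
  refine ⟨N * (CQ * K) + 1, by positivity, fun ε k θ₁ θ₂ x₁ x₂ u hε hθ₁ hθ₂ hx₁ hx₂ hB => ?_⟩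
  have hu : ∀ i < N, ‖u i‖ ≤ √(B / cR) + ru := by
    intro i hi
    have h1 := (hRb _).1.trans ((wsq_input_le_seqCost _ xr ur hQ hR hi x₁ k u).trans hB)
    have h2 : ‖u i - ur (k + i)‖ ≤ √(B / cR) := by
      apply Real.le_sqrt_of_sq_le
      rwa [le_div_iff₀' hcR]
    have h3 : ‖u i‖ ≤ ‖u i - ur (k + i)‖ + ‖ur (k + i)‖ := by
      simpa using norm_add_le (u i - ur (k + i)) (ur (k + i))
    linarith [hur (k + i)]
  set D := ‖x₁ - x₂‖ ^ 2 + ‖θ₁ - θ₂‖ ^ 2 with hD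
  have hD0 : 0 ≤ D := by positivity
  have hstage : ∀ i ∈ Finset.range N, stage (model f₀ f θ₂) Q R xr ur x₂ k u i ≤
      (1 + ε) * stage (model f₀ f θ₁) Q R xr ur x₁ k u i + (1 + ε⁻¹) * (CQ * K * D) := by
    intro i hi
    have hi' := Finset.mem_range.1 hi
    have h1 := hK θ₂ θ₁ x₂ x₁ u (hθ₂.trans (le_max_left _ _)) (hθ₁.trans (le_max_left _ _))
      (hx₂.trans (le_max_left _ _)) (hx₁.trans (le_max_left _ _))
      (fun j hj => (hu j hj).trans (le_max_right _ _)) i hi'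
    rw [norm_sub_rev x₂, norm_sub_rev θ₂] at h1
    have h2 := wsq_add_le hQ (traj (model f₀ f θ₁) x₁ u i - xr (k + i))
      (traj (model f₀ f θ₂) x₂ u i - traj (model f₀ f θ₁) x₁ u i) hε
    rw [show traj (model f₀ f θ₁) x₁ u i - xr (k + i) +
      (traj (model f₀ f θ₂) x₂ u i - traj (model f₀ f θ₁) x₁ u i) =
      traj (model f₀ f θ₂) x₂ u i - xr (k + i) by abel] at h2
    have h3 : wsq Q (traj (model f₀ f θ₂) x₂ u i - traj (model f₀ f θ₁) x₁ u i) ≤ CQ * K * D := by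
      refine (hQb _).2.trans ?_
      rw [mul_assoc]
      gcongr
    have h4 : (1 + ε⁻¹) * wsq Q (traj (model f₀ f θ₂) x₂ u i - traj (model f₀ f θ₁) x₁ u i) ≤
        (1 + ε⁻¹) * (CQ * K * D) := by gcongr
    have h5 := mul_nonneg hε.le (wsq_nonneg hR (u i - ur (k + i)))
    rw [stage, stage]
    linarith
  have hsum := Finset.sum_le_sum hstage
  rw [Finset.sum_add_distrib, ← Finset.mul_sum] at hsum
  simp only [Finset.sum_const, Finset.card_range, nsmul_eq_mul] at hsum
  have h6 : 0 ≤ (1 + ε⁻¹) * D := by positivity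
  unfold seqCost
  linarith

end Sensitivity

/-! ### One step of the closed loop -/

section Step

variable {f₀ : Vec n → Vec m → Vec n} {f : Fin S → Vec n → Vec m → Vec n}
  {Q : Matrix (Fin n) (Fin n) ℝ} {R : Matrix (Fin m) (Fin m) ℝ}

/-- A minimizer for the parameter `θ'` is a near-minimizer for the parameter `θ`: its excess cost
is a small multiple of the optimal value plus a multiple of `‖θ - θ'‖ ^ 2`. -/
lemma seqCost_le_of_isMinimizer {xr : ℕ → Vec n} {ur : ℕ → Vec m} {N k : ℕ} {θ θ' : Vec S}
    {x : Vec n} {û : ℕ → Vec m} {ε B E d : ℝ} (hε : 0 < ε) (hε1 : ε ≤ 1) (hB : 5 ≤ B)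
    (hE : 0 ≤ E * d ^ 2) (hE1 : E * d ^ 2 ≤ 1)
    (hto : ∀ u, seqCost (model f₀ f θ) Q R xr ur N x k u ≤ B →
      seqCost (model f₀ f θ') Q R xr ur N x k u ≤
        (1 + ε) * seqCost (model f₀ f θ) Q R xr ur N x k u + E * d ^ 2)
    (hback : ∀ u, seqCost (model f₀ f θ') Q R xr ur N x k u ≤ B →
      seqCost (model f₀ f θ) Q R xr ur N x k u ≤
        (1 + ε) * seqCost (model f₀ f θ') Q R xr ur N x k u + E * d ^ 2)
    (hmin : ∀ u, seqCost (model f₀ f θ') Q R xr ur N x k û ≤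
      seqCost (model f₀ f θ') Q R xr ur N x k u)
    (hV0 : 0 ≤ value (model f₀ f θ) Q R xr ur N x k)
    (hV : value (model f₀ f θ) Q R xr ur N x k ≤ 1) :
    seqCost (model f₀ f θ) Q R xr ur N x k û ≤
      (1 + 3 * ε) * value (model f₀ f θ) Q R xr ur N x k + 3 * (E * d ^ 2) := by
  set V := value (model f₀ f θ) Q R xr ur N x k with hVdef
  have key : ∀ c, V < c → c ≤ 2 → seqCost (model f₀ f θ) Q R xr ur N x k û ≤
      (1 + ε) ^ 2 * c + 3 * (E * d ^ 2) := by
    intro c hc hc2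
    obtain ⟨u, hu⟩ := exists_seqCost_lt_of_value_lt _ xr ur hc
    have h1 := hto u (by linarith)
    have h2 := (hmin u).trans h1
    have h3 : (1 + ε) * seqCost (model f₀ f θ) Q R xr ur N x k u ≤ (1 + ε) * c := by gcongr
    have h4 : (1 + ε) * c ≤ 2 * 2 := by nlinarith
    have h5 := hback û (by linarith)
    have h6 : (1 + ε) * seqCost (model f₀ f θ') Q R xr ur N x k û ≤
      (1 + ε) * ((1 + ε) * c + E * d ^ 2) := by gcongr; linarith
    nlinarith
  have hlim : seqCost (model f₀ f θ) Q R xr ur N x k û ≤ (1 + ε) ^ 2 * V + 3 * (E * d ^ 2) := by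
    refine le_of_forall_pos_le_add fun δ hδ => ?_
    have h := key (V + min 1 (δ / 4)) (lt_add_of_pos_right _ (by positivity))
      (by linarith [min_le_left 1 (δ / 4)])
    have h1 : (1 + ε) ^ 2 * min 1 (δ / 4) ≤ 4 * (δ / 4) :=
      mul_le_mul (by nlinarith) (min_le_right _ _) (by positivity) (by norm_num)
    linarith
  have hsq : (1 + ε) ^ 2 ≤ 1 + 3 * ε := by nlinarith
  linarith [mul_le_mul_of_nonneg_right hsq hV0]

set_option maxHeartbeats 400000 in
/-- For long horizons, the optimal value of the true model contracts along the closed loop of the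
MPC with parameter `θ'`, up to the squares of the parameter error and of the disturbance. -/
lemma exists_value_contraction (hC2 : BasisC2 f₀ f) (hQ : Q.PosDef) (hR : R.PosDef)
    (θ : Vec S) {Z : Set (Vec n × Vec m)}
    (hstab : LocallyIncrementallyStabilizable (model f₀ f θ) Z) {M : ℕ} {xr : ℕ → Vec n}
    {ur : ℕ → Vec m} (href : IsFeasiblePeriodic (model f₀ f θ) M xr ur)
    (hZ : ∀ k, (xr k, ur k) ∈ Z) :
    ∃ N₀ : ℕ, 0 < N₀ ∧ ∀ N, N₀ ≤ N → ∃ v d η C : ℝ, 0 < v ∧ 0 < d ∧ 0 < η ∧ η < 1 ∧ 0 < C ∧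
      (∀ k x, ‖x - xr k‖ ≤ d →
        value (model f₀ f θ) Q R xr ur N x k ≤ C * ‖x - xr k‖ ^ 2) ∧
      ∀ k x θ' u w, value (model f₀ f θ) Q R xr ur N x k ≤ v → ‖θ - θ'‖ ≤ d → ‖w‖ ≤ 1 →
        IsMPCInput (model f₀ f θ') Q R xr ur N x k u →
        value (model f₀ f θ) Q R xr ur N (model f₀ f θ x u + w) (k + 1) ≤
          η * value (model f₀ f θ) Q R xr ur N x k + C * (‖θ - θ'‖ ^ 2 + ‖w‖ ^ 2) ∧
        ‖u - ur k‖ ^ 2 ≤ C * (value (model f₀ f θ) Q R xr ur N x k + ‖θ - θ'‖ ^ 2) := by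
  obtain ⟨ε₀, γ, hε₀, hγ, hcand⟩ := exists_stabilizing_sequence hQ hR hstab href hZ
  obtain ⟨cQ, CQ, hcQ, hCQ, hQb⟩ := exists_wsq_bounds hQ
  obtain ⟨cR, CR, hcR, hCR, hRb⟩ := exists_wsq_bounds hR
  obtain ⟨r, hr, hrb⟩ := href.exists_bound
  have hγ0 : 0 < γ := by linarith
  have hγi : 0 < γ⁻¹ := inv_pos.2 hγ0
  have hq0 : 0 ≤ 1 - γ⁻¹ := sub_nonneg.2 (inv_le_one_of_one_le₀ hγ.le)
  have hq1 : 1 - γ⁻¹ < 1 := by linarith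
  obtain ⟨j, hj⟩ := exists_pow_lt_of_lt_one (show 0 < γ⁻¹ * γ⁻¹ by positivity) hq1
  refine ⟨j + 2, by omega, fun N hN => ?_⟩
  obtain ⟨p, rfl⟩ : ∃ p, N = p + 2 := ⟨N - 2, by omega⟩
  have hjp : j ≤ p + 1 := by omega
  set η₀ : ℝ := 1 - γ⁻¹ + γ * (1 - γ⁻¹) ^ (p + 1) with hη₀
  have hη₀0 : 0 ≤ η₀ := by positivity
  have hη₀1 : η₀ < 1 := by
    have h1 : (1 - γ⁻¹) ^ (p + 1) < γ⁻¹ * γ⁻¹ :=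
      (pow_le_pow_of_le_one hq0 hq1.le hjp).trans_lt hj
    have h2 := mul_lt_mul_of_pos_left h1 hγ0
    rw [mul_inv_cancel_left₀ hγ0.ne'] at h2
    linarith
  set τ : ℝ := γ⁻¹ + γ with hτ
  have hτ0 : 0 < τ := by positivity
  -- `ε` is so small that `(1 + ε) * (η₀ + 3 * (1 + τ) * ε)` is at most `(1 + η₀) / 2`.
  set ε : ℝ := (1 - η₀) / (2 * (7 + 6 * τ)) with hε_def
  have hε : 0 < ε := div_pos (by linarith) (by positivity)
  have hεη : ε * (7 + 6 * τ) = (1 - η₀) / 2 := by rw [hε_def]; field_simp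
  have hε1 : ε ≤ 1 := by nlinarith
  have hcontr : (1 + ε) * (η₀ + 3 * (1 + τ) * ε) ≤ (1 + η₀) / 2 := by
    have h1 : ε * η₀ ≤ ε * 1 := by gcongr
    have h2 : (1 + τ) * (ε * ε) ≤ (1 + τ) * (ε * 1) := by gcongr
    linarith
  obtain ⟨C₁, hC₁, hpert⟩ := exists_seqCost_perturbation hC2 hQ hR (fun k => (hrb k).2) (p + 2)
    (xr := xr) (‖θ‖ + r + ε₀ + 1) (5 + τ)
  set E : ℝ := (1 + ε⁻¹) * C₁ with hE_def
  have hE : 0 < E := by positivity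
  set v₁ : ℝ := min (cQ * ε₀ ^ 2) 1 with hv₁
  have hv₁0 : 0 < v₁ := by positivity
  have hv₁1 : v₁ ≤ 1 := min_le_right _ _
  have hsmall : ∀ e : Vec n, wsq Q e ≤ v₁ → ‖e‖ ≤ ε₀ := fun e he => by
    have h := ((hQb e).1.trans he).trans (min_le_left _ _)
    exact le_of_sq_le_sq (le_of_mul_le_mul_left h hcQ) hε₀.le
  refine ⟨v₁ / 8, min (min 1 ε₀) (v₁ / (6 * E)), (1 + η₀) / 2,
    6 * (1 + τ) * E + E + (4 + 3 * E) / cR + γ * CQ, by positivity, by positivity, by linarith,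
    by linarith, by positivity, ?_, ?_⟩
  · intro k x hx
    obtain ⟨u, hu⟩ := hcand (p + 2) k x
      (hx.trans ((min_le_left _ _).trans (min_le_right _ _)))
    have h1 : γ * wsq Q (x - xr k) ≤ γ * (CQ * ‖x - xr k‖ ^ 2) := by gcongr; exact (hQb _).2
    have h2 : 0 ≤ (6 * (1 + τ) * E + E + (4 + 3 * E) / cR) * ‖x - xr k‖ ^ 2 := by positivity
    linarith [value_le_seqCost (model f₀ f θ) xr ur hQ hR (p + 2) x k u]
  intro k x θ' u₀ w hV hd hw hmpc
  have hV0 := value_nonneg (model f₀ f θ) xr ur hQ hR (p + 2) x k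
  have hstate := wsq_le_value (model f₀ f θ) xr ur hQ hR (show 0 < p + 2 by omega) x k
  set V := value (model f₀ f θ) Q R xr ur (p + 2) x k with hVdef
  set d := ‖θ - θ'‖ with hd_def
  have hd0 : 0 ≤ d := norm_nonneg _
  have hd1 : d ≤ 1 := hd.trans ((min_le_left _ _).trans (min_le_left _ _))
  have hEd : E * d ^ 2 ≤ v₁ / 6 := by
    have h1 : d ≤ v₁ / (6 * E) := hd.trans (min_le_right _ _)
    have h2 : E * d ≤ v₁ / 6 := by
      rw [le_div_iff₀ (by positivity)] at h1 ⊢; linarith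
    have h3 : E * d * d ≤ E * d * 1 := by gcongr
    linarith only [h2, h3]
  have hEd0 : 0 ≤ E * d ^ 2 := by positivity
  have hθ : ‖θ‖ ≤ ‖θ‖ + r + ε₀ + 1 := by linarith
  have hθ' : ‖θ'‖ ≤ ‖θ‖ + r + ε₀ + 1 := by
    have : ‖θ'‖ ≤ ‖θ‖ + ‖θ - θ'‖ := by
      simpa using norm_sub_le θ (θ - θ')
    linarith
  have hstate_bound : ∀ (y z : Vec n) (l : ℕ), ‖y - xr l‖ ≤ ε₀ → ‖z‖ ≤ 1 →
      ‖y + z‖ ≤ ‖θ‖ + r + ε₀ + 1 := by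
    intro y z l hy hz
    have h1 : ‖y + z‖ ≤ ‖y - xr l‖ + ‖xr l‖ + ‖z‖ := by
      calc ‖y + z‖ = ‖y - xr l + xr l + z‖ := by congr 1; abel
        _ ≤ _ := norm_add₃_le
    linarith [(hrb l).1, norm_nonneg θ]
  have hx : ‖x‖ ≤ ‖θ‖ + r + ε₀ + 1 := by
    simpa using hstate_bound x 0 k (hsmall _ (by linarith)) (by simp)
  obtain ⟨û, hû0, hmin⟩ := hmpc.exists_seq
  have hJ := seqCost_le_of_isMinimizer (B := 5 + τ) (E := E) (d := d) (θ := θ) hε hε1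
    (by linarith) hEd0 (by linarith)
    (fun u hu => by
      have h := hpert ε k θ θ' x x u hε hθ hθ' hx hx hu
      simp only [sub_self, norm_zero] at h
      rw [hE_def]
      linarith)
    (fun u hu => by
      have h := hpert ε k θ' θ x x u hε hθ' hθ hx hx hu
      simp only [sub_self, norm_zero, norm_sub_rev θ' θ] at h
      rw [hE_def]
      linarith)
    hmin hV0 (by linarith)
  rw [← hVdef] at hJ
  set J := seqCost (model f₀ f θ) Q R xr ur (p + 2) x k û with hJdef
  set g := 3 * ε * V + 3 * (E * d ^ 2) with hg_def
  have hg : 0 ≤ g := by positivity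
  have hεV : ε * V ≤ V := mul_le_of_le_one_left hV0 hε1
  have hJv : J ≤ v₁ := by linarith
  obtain ⟨v, hv⟩ := exists_shifted_sequence hQ hR hγ hcand hsmall hg hJv (fun v => by
    have := value_le_seqCost (model f₀ f θ) xr ur hQ hR (p + 2) x k v
    linarith)
  rw [hû0, ← hJdef, ← hη₀, ← hτ] at hv
  have hJV : J ≤ V + g := by linarith
  have hJ0 : 0 ≤ J := seqCost_nonneg _ xr ur hQ hR _ _ _ _
  have hJ1 : η₀ * J ≤ V + g := (mul_le_of_le_one_left hJ0 hη₀1.le).trans hJV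
  have hB : seqCost (model f₀ f θ) Q R xr ur (p + 2) (model f₀ f θ x u₀) (k + 1) v ≤ 5 + τ := by
    have : τ * g ≤ τ * 1 := by gcongr; linarith
    linarith
  have hx1 : ‖model f₀ f θ x u₀ - xr (k + 1)‖ ≤ ε₀ := by
    refine hsmall _ (le_trans ?_ hJv)
    have := wsq_state_le_seqCost (model f₀ f θ) xr ur hQ hR (show 1 < p + 2 by omega) x k û
    rwa [traj, hû0] at this
  have hx2 : ‖model f₀ f θ x u₀‖ ≤ ‖θ‖ + r + ε₀ + 1 := by
    simpa using hstate_bound (model f₀ f θ x u₀) 0 (k + 1) hx1 (by simp)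
  have hfinal := hpert ε (k + 1) θ θ _ (model f₀ f θ x u₀ + w) v hε hθ hθ hx2
    (hstate_bound _ _ _ hx1 hw) hB
  simp only [sub_self, norm_zero, sub_add_cancel_left, norm_neg] at hfinal
  have hval := value_le_seqCost (model f₀ f θ) xr ur hQ hR (p + 2) (model f₀ f θ x u₀ + w)
    (k + 1) v
  have hEw : 0 ≤ E * ‖w‖ ^ 2 := by positivity
  constructor
  · have h1 : (1 + ε) * seqCost (model f₀ f θ) Q R xr ur (p + 2) (model f₀ f θ x u₀) (k + 1) v ≤
        (1 + ε) * (η₀ * (V + g) + τ * g) := by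
      gcongr
      have := mul_le_mul_of_nonneg_left hJV hη₀0
      linarith
    have h2 : η₀ * (V + g) + τ * g ≤ η₀ * V + (1 + τ) * g := by
      have := mul_le_of_le_one_left hg hη₀1.le
      linarith only [this]
    have h3 : (1 + ε) * (η₀ * V + (1 + τ) * g) ≤
        (1 + η₀) / 2 * V + 6 * (1 + τ) * (E * d ^ 2) := by
      have h5 := mul_le_mul_of_nonneg_right hcontr hV0
      have h6 : (1 + ε) * ((1 + τ) * (3 * (E * d ^ 2))) ≤ 2 * ((1 + τ) * (3 * (E * d ^ 2))) := by
        gcongr; linarith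
      rw [hg_def]
      linarith only [h5, h6]
    have h7 : (1 + ε) * (η₀ * (V + g) + τ * g) ≤ (1 + ε) * (η₀ * V + (1 + τ) * g) := by gcongr
    have h8 : 0 ≤ (6 * (1 + τ) * E + (4 + 3 * E) / cR + γ * CQ) * ‖w‖ ^ 2 := by positivity
    have h9 : 0 ≤ (E + (4 + 3 * E) / cR + γ * CQ) * d ^ 2 := by positivity
    have h10 : (1 + ε⁻¹) * (C₁ * (‖w‖ ^ 2 + 0 ^ 2)) = E * ‖w‖ ^ 2 := by rw [hE_def]; ring
    rw [h10] at hfinal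
    linarith only [hval, hfinal, h1, h7, h3, h8, h9]
  · have h1 := (hRb (û 0 - ur (k + 0))).1.trans
      (wsq_input_le_seqCost (model f₀ f θ) xr ur hQ hR (show 0 < p + 2 by omega) x k û)
    rw [hû0, add_zero, ← hJdef] at h1
    have h2 : ‖u₀ - ur k‖ ^ 2 ≤ (4 * V + 3 * E * d ^ 2) / cR := by
      rw [le_div_iff₀' hcR]; linarith
    have h3 : (4 * V + 3 * E * d ^ 2) / cR ≤ (4 + 3 * E) / cR * (V + d ^ 2) := by
      rw [div_mul_eq_mul_div]
      gcongr
      linarith only [mul_nonneg hE.le hV0, sq_nonneg d]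
    have h4 : 0 ≤ (6 * (1 + τ) * E + E + γ * CQ) * (V + d ^ 2) := by positivity
    linarith only [h2, h3, h4]

end Step

/-! ### Recursive least squares in information form -/

section LeastSquares

variable {lam : ℝ} {T : Matrix (Fin n) (Fin n) ℝ} {Λ : Matrix (Fin S) (Fin S) ℝ}

/-- The update `Λ ↦ λ Λ + φ T⁻¹ φᵀ` of the information matrix `Λ = P⁻¹`. -/
noncomputable def infoUpdate (lam : ℝ) (T : Matrix (Fin n) (Fin n) ℝ)
    (Λ : Matrix (Fin S) (Fin S) ℝ) (φ : Matrix (Fin S) (Fin n) ℝ) : Matrix (Fin S) (Fin S) ℝ :=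
  lam • Λ + φ * T⁻¹ * φ.transpose

/-- The output `φᵀ z` of the regression, as a Euclidean vector. -/
noncomputable def regOut (φ : Matrix (Fin S) (Fin n) ℝ) (z : Vec S) : Vec n :=
  WithLp.toLp 2 (φ.transpose.mulVec z.ofLp)

lemma infoUpdate_posDef (hlam : 0 < lam) (hT : T.PosDef) (hΛ : Λ.PosDef)
    (φ : Matrix (Fin S) (Fin n) ℝ) : (infoUpdate lam T Λ φ).PosDef := by
  have h := hT.inv.posSemidef.mul_mul_conjTranspose_same φ
  rw [Matrix.conjTranspose_eq_transpose_of_trivial] at h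
  exact (hΛ.smul hlam).add_posSemidef h

lemma rlsD_posDef (hlam : 0 < lam) (hT : T.PosDef) {P : Matrix (Fin S) (Fin S) ℝ} (hP : P.PosDef)
    (φ : Matrix (Fin S) (Fin n) ℝ) : (rlsD lam T P φ).PosDef := by
  have h := hP.posSemidef.conjTranspose_mul_mul_same φ
  rw [Matrix.conjTranspose_eq_transpose_of_trivial] at h
  exact (hT.smul hlam).add_posSemidef h

/-- The covariance update inverts the information update (Woodbury identity). -/
lemma rlsP_inv_eq (hlam : 0 < lam) (hT : T.PosDef) (hΛ : Λ.PosDef)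
    (φ : Matrix (Fin S) (Fin n) ℝ) : rlsP lam T Λ⁻¹ φ = (infoUpdate lam T Λ φ)⁻¹ := by
  have hD := rlsD_posDef hlam hT hΛ.inv φ
  have hA : (lam • Λ)⁻¹ = lam⁻¹ • Λ⁻¹ := by
    refine Matrix.inv_eq_left_inv ?_
    rw [smul_mul_smul_comm, inv_mul_cancel₀ hlam.ne',
      Matrix.nonsing_inv_mul _ ((Matrix.isUnit_iff_isUnit_det _).1 hΛ.isUnit), one_smul]
  have hC : T⁻¹⁻¹ + φ.transpose * (lam • Λ)⁻¹ * φ = lam⁻¹ • rlsD lam T Λ⁻¹ φ := by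
    rw [hA, Matrix.nonsing_inv_nonsing_inv _ ((Matrix.isUnit_iff_isUnit_det _).1 hT.isUnit),
      rlsD, smul_add, smul_smul, inv_mul_cancel₀ hlam.ne', one_smul, Matrix.mul_smul,
      Matrix.smul_mul]
  have hCi : (lam⁻¹ • rlsD lam T Λ⁻¹ φ)⁻¹ = lam • (rlsD lam T Λ⁻¹ φ)⁻¹ := by
    refine Matrix.inv_eq_left_inv ?_
    rw [smul_mul_smul_comm, mul_inv_cancel₀ hlam.ne',
      Matrix.nonsing_inv_mul _ ((Matrix.isUnit_iff_isUnit_det _).1 hD.isUnit), one_smul]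
  rw [infoUpdate, Matrix.add_mul_mul_inv_eq_sub _ _ _ _ (hΛ.smul hlam).isUnit hT.inv.isUnit
    (by rw [hC]; exact (hD.smul (inv_pos.2 hlam)).isUnit), hC, hCi, hA, rlsP]
  simp only [Matrix.sub_mul, Matrix.one_mul, smul_sub, Matrix.smul_mul, Matrix.mul_smul, smul_smul]
  congr 2
  field_simp

/-- The least-squares gain `P φ D⁻¹` equals `P⁺ φ T⁻¹`. -/
lemma infoUpdate_mul_gain (hlam : 0 < lam) (hT : T.PosDef) (hΛ : Λ.PosDef)
    (φ : Matrix (Fin S) (Fin n) ℝ) :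
    infoUpdate lam T Λ φ * (Λ⁻¹ * φ * (rlsD lam T Λ⁻¹ φ)⁻¹) = φ * T⁻¹ := by
  have hD := rlsD_posDef hlam hT hΛ.inv φ
  have h : infoUpdate lam T Λ φ * (Λ⁻¹ * φ) = φ * T⁻¹ * rlsD lam T Λ⁻¹ φ := by
    rw [infoUpdate, rlsD, Matrix.add_mul, Matrix.mul_add, Matrix.smul_mul, ← Matrix.mul_assoc Λ,
      Matrix.mul_nonsing_inv _ ((Matrix.isUnit_iff_isUnit_det _).1 hΛ.isUnit), Matrix.one_mul,
      Matrix.mul_smul, Matrix.mul_assoc φ T⁻¹ T,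
      Matrix.nonsing_inv_mul _ ((Matrix.isUnit_iff_isUnit_det _).1 hT.isUnit), Matrix.mul_one]
    simp only [Matrix.mul_assoc]
  rw [← Matrix.mul_assoc, h, Matrix.mul_assoc,
    Matrix.mul_nonsing_inv _ ((Matrix.isUnit_iff_isUnit_det _).1 hD.isUnit), Matrix.mul_one]

lemma infoUpdate_mulVec_error (hlam : 0 < lam) (hT : T.PosDef) (hΛ : Λ.PosDef)
    (φ : Matrix (Fin S) (Fin n) ℝ) (θ θhat : Vec S) (w : Vec n) :
    (infoUpdate lam T Λ φ).mulVec
        (θ - rlsEstimate lam T Λ⁻¹ φ (regOut φ θ + w) θhat).ofLp =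
      lam • Λ.mulVec (θ - θhat).ofLp - (φ * T⁻¹).mulVec w.ofLp := by
  have hy : (regOut φ θ + w).ofLp - φ.transpose.mulVec θhat.ofLp =
      φ.transpose.mulVec (θ - θhat).ofLp + w.ofLp := by
    rw [WithLp.ofLp_add, WithLp.ofLp_sub, Matrix.mulVec_sub]
    simp only [regOut]
    abel
  have he : (θ - rlsEstimate lam T Λ⁻¹ φ (regOut φ θ + w) θhat).ofLp = (θ - θhat).ofLp -
      (Λ⁻¹ * φ * (rlsD lam T Λ⁻¹ φ)⁻¹).mulVec
        (φ.transpose.mulVec (θ - θhat).ofLp + w.ofLp) := by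
    rw [rlsEstimate, hy]
    simp only [WithLp.ofLp_sub, WithLp.ofLp_add]
    abel
  rw [he, Matrix.mulVec_sub, Matrix.mulVec_mulVec, infoUpdate_mul_gain hlam hT hΛ, infoUpdate,
    Matrix.add_mulVec, Matrix.mulVec_add, Matrix.mulVec_mulVec, Matrix.smul_mulVec]
  abel

lemma wsq_infoUpdate (φ : Matrix (Fin S) (Fin n) ℝ) (z : Vec S) :
    wsq (infoUpdate lam T Λ φ) z = lam * wsq Λ z + wsq T⁻¹ (regOut φ z) := by
  simp only [wsq, infoUpdate, regOut, Matrix.add_mulVec, dotProduct_add, Matrix.smul_mulVec,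
    dotProduct_smul, smul_eq_mul]
  congr 1
  rw [← Matrix.mulVec_mulVec, ← Matrix.mulVec_mulVec, Matrix.dotProduct_mulVec,
    ← Matrix.mulVec_transpose]

/-- The Lyapunov inequality of recursive least squares: the error weighted by the information
matrix decays with the forgetting factor, up to the weighted square of the disturbance. -/
lemma wsq_error_le (hlam : 0 < lam) (hT : T.PosDef) (hΛ : Λ.PosDef)
    (φ : Matrix (Fin S) (Fin n) ℝ) (θ θhat : Vec S) (w : Vec n) :
    wsq (infoUpdate lam T Λ φ) (θ - rlsEstimate lam T Λ⁻¹ φ (regOut φ θ + w) θhat) ≤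
      lam * wsq Λ (θ - θhat) + wsq T⁻¹ w := by
  have hrel := infoUpdate_mulVec_error hlam hT hΛ φ θ θhat w
  set z := θ - rlsEstimate lam T Λ⁻¹ φ (regOut φ θ + w) θhat with hz
  -- Pair the relation between the two errors with the new error and complete both squares.
  have h1 : wsq (infoUpdate lam T Λ φ) z =
      lam * wdot Λ z (θ - θhat) - wdot T⁻¹ (regOut φ z) w := by
    rw [wsq, hrel, dotProduct_sub, dotProduct_smul, smul_eq_mul, ← Matrix.mulVec_mulVec,
      Matrix.dotProduct_mulVec z.ofLp φ, ← Matrix.mulVec_transpose]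
    rfl
  have h2 := wsq_infoUpdate (lam := lam) (T := T) (Λ := Λ) φ z
  have h3 := mul_nonneg hlam.le (wsq_nonneg hΛ (z - (θ - θhat)))
  have h4 := wsq_nonneg hT.inv (regOut φ z + w)
  rw [wsq_sub hΛ] at h3
  rw [wsq_add hT.inv] at h4
  linarith

end LeastSquares

/-! ### Persistency of excitation near the reference -/

section Excitation

variable {f₀ : Vec n → Vec m → Vec n} {f : Fin S → Vec n → Vec m → Vec n}

lemma regOut_regressor (x : Vec n) (u : Vec m) (z : Vec S) :
    regOut (regressor f x u) z = ∑ j, z j • f j x u := by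
  ext i
  simp [regOut, regressor, Matrix.mulVec, dotProduct, mul_comm]

lemma norm_sq_eq_dotProduct {d : ℕ} (v : Vec d) : ‖v‖ ^ 2 = v.ofLp ⬝ᵥ v.ofLp := by
  rw [EuclideanSpace.real_norm_sq_eq]
  simp [dotProduct, sq]

lemma dotProduct_gram (φ : Matrix (Fin S) (Fin n) ℝ) (z : Vec S) :
    z.ofLp ⬝ᵥ (φ * φ.transpose).mulVec z.ofLp = ‖regOut φ z‖ ^ 2 := by
  rw [norm_sq_eq_dotProduct, ← Matrix.mulVec_mulVec, Matrix.dotProduct_mulVec,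
    ← Matrix.mulVec_transpose]
  rfl

lemma IsPE.exists_lower {M : ℕ} {xr : ℕ → Vec n} {ur : ℕ → Vec m} (h : IsPE f M xr ur) :
    ∃ α > 0, ∀ (j : ℕ) (z : Vec S), α * ‖z‖ ^ 2 ≤
      ∑ i ∈ Finset.range M, ‖regOut (regressor f (xr (j + i)) (ur (j + i))) z‖ ^ 2 := by
  obtain ⟨α, β, hα, -, h⟩ := h
  refine ⟨α, hα, fun j z => ?_⟩
  have h1 := (h j).1.dotProduct_mulVec_nonneg z.ofLp
  rw [Finset.sum_Ico_eq_sum_range, Nat.add_sub_cancel_left] at h1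
  simp only [star_trivial, Matrix.sub_mulVec, Matrix.smul_mulVec, Matrix.one_mulVec,
    dotProduct_sub, dotProduct_smul, smul_eq_mul, ← norm_sq_eq_dotProduct, Matrix.sum_mulVec,
    dotProduct_sum, dotProduct_gram] at h1
  linarith

/-- Along trajectories close to the reference the regressor is close to that of the reference. -/
lemma exists_regressor_close (hC2 : BasisC2 f₀ f) {F : Vec n → Vec m → Vec n} {M : ℕ}
    {xr : ℕ → Vec n} {ur : ℕ → Vec m} (href : IsFeasiblePeriodic F M xr ur) {δ : ℝ} (hδ : 0 < δ) :
    ∃ r > 0, ∀ k x u, ‖x - xr k‖ ≤ r → ‖u - ur k‖ ≤ r → ∀ z : Vec S,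
      ‖regOut (regressor f x u) z - regOut (regressor f (xr k) (ur k)) z‖ ≤ δ * ‖z‖ := by
  refine href.exists_uniform_radius (p := fun x' u' r => ∀ x u, ‖x - x'‖ ≤ r → ‖u - u'‖ ≤ r →
    ∀ z : Vec S, ‖regOut (regressor f x u) z - regOut (regressor f x' u') z‖ ≤ δ * ‖z‖)
    (fun k => ?_) (fun x' u' r s _ hsr h x u hx hu => h x u (hx.trans hsr) (hu.trans hsr))
  have hcont : Continuous fun p : Vec n × Vec m =>
      ∑ j, ‖f j p.1 p.2 - f j (xr k) (ur k)‖ :=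
    continuous_finsetSum _ fun j _ => ((hC2.2 j).continuous.sub continuous_const).norm
  have hnear : ∀ᶠ p in 𝓝 (xr k, ur k), ∑ j, ‖f j p.1 p.2 - f j (xr k) (ur k)‖ < δ :=
    hcont.continuousAt.eventually_lt continuousAt_const (by simpa using hδ)
  obtain ⟨r, hr, h⟩ := Metric.eventually_nhds_iff.1 hnear
  refine ⟨r / 2, half_pos hr, fun x u hx hu z => ?_⟩
  have hsum := h (y := (x, u)) (by
    rw [Prod.dist_eq, dist_eq_norm, dist_eq_norm]
    exact max_lt (by simp only; linarith) (by simp only; linarith))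
  rw [regOut_regressor, regOut_regressor, ← Finset.sum_sub_distrib]
  calc ‖∑ j, (z j • f j x u - z j • f j (xr k) (ur k))‖
      ≤ ∑ j, ‖z‖ * ‖f j x u - f j (xr k) (ur k)‖ := by
        refine norm_sum_le_of_le _ fun j _ => ?_
        rw [← smul_sub, norm_smul]
        gcongr
        exact PiLp.norm_apply_le z j
    _ = ‖z‖ * ∑ j, ‖f j x u - f j (xr k) (ur k)‖ := by rw [Finset.mul_sum]
    _ ≤ δ * ‖z‖ := by rw [mul_comm]; gcongr

/-- If a trajectory stays near a persistently exciting reference up to time `k`, the information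
matrix at time `k` is bounded below by a positive constant that does not depend on `k`. For
`k < M` the bound comes from the initial information matrix, later from the last `M` regressors. -/
lemma exists_information_lower_bound (hC2 : BasisC2 f₀ f) {F : Vec n → Vec m → Vec n} {M : ℕ}
    {xr : ℕ → Vec n} {ur : ℕ → Vec m} (href : IsFeasiblePeriodic F M xr ur)
    (hPE : IsPE f M xr ur) {lam : ℝ} (hlam0 : 0 < lam) (hlam1 : lam < 1)
    {T : Matrix (Fin n) (Fin n) ℝ} (hT : T.PosDef) {Λ₀ : Matrix (Fin S) (Fin S) ℝ}
    (hΛ₀ : Λ₀.PosDef) :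
    ∃ r p : ℝ, 0 < r ∧ 0 < p ∧ ∀ (x : ℕ → Vec n) (u : ℕ → Vec m)
      (Λ : ℕ → Matrix (Fin S) (Fin S) ℝ), Λ 0 = Λ₀ → (∀ k, (Λ k).PosDef) →
      (∀ k, Λ (k + 1) = infoUpdate lam T (Λ k) (regressor f (x k) (u k))) →
      ∀ k, (∀ i < k, ‖x i - xr i‖ ≤ r ∧ ‖u i - ur i‖ ≤ r) →
        ∀ z : Vec S, p * ‖z‖ ^ 2 ≤ wsq (Λ k) z := by
  obtain ⟨α, hα, hαb⟩ := hPE.exists_lower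
  obtain ⟨cT, CT, hcT, hCT, hTb⟩ := exists_wsq_bounds hT.inv
  obtain ⟨c₀, C₀, hc₀, hC₀, h₀b⟩ := exists_wsq_bounds hΛ₀
  have hM : (0 : ℝ) < M := Nat.cast_pos.2 href.period_pos
  set δ : ℝ := √(α / (4 * M)) with hδ
  have hδ0 : 0 < δ := Real.sqrt_pos.2 (by positivity)
  have hδsq : M * δ ^ 2 = α / 4 := by
    rw [hδ, Real.sq_sqrt (by positivity)]; field_simp
  obtain ⟨r, hr, hclose⟩ := exists_regressor_close hC2 href hδ0
  refine ⟨r, lam ^ M * min c₀ (cT * (α / 4)), hr, by positivity,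
    fun x u Λ hΛ0 hΛpos hΛ k hk z => ?_⟩
  have hunroll : ∀ j i, lam ^ i * (wsq (Λ j) z + ∑ l ∈ Finset.range i,
      wsq T⁻¹ (regOut (regressor f (x (j + l)) (u (j + l))) z)) ≤ wsq (Λ (j + i)) z := by
    intro j i
    induction i with
    | zero => simp
    | succ i ih =>
      have hnn := wsq_nonneg hT.inv (regOut (regressor f (x (j + i)) (u (j + i))) z)
      have h1 : lam ^ (i + 1) * wsq T⁻¹ (regOut (regressor f (x (j + i)) (u (j + i))) z) ≤
          wsq T⁻¹ (regOut (regressor f (x (j + i)) (u (j + i))) z) :=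
        mul_le_of_le_one_left hnn (pow_le_one₀ hlam0.le hlam1.le)
      have h2 := mul_le_mul_of_nonneg_left ih hlam0.le
      rw [← add_assoc, hΛ, wsq_infoUpdate, Finset.sum_range_succ]
      rw [← mul_assoc, ← pow_succ'] at h2
      linarith
  have hpow : ∀ {i a : ℝ}, i ≤ a → lam ^ M * i * ‖z‖ ^ 2 ≤ lam ^ M * (a * ‖z‖ ^ 2) := by
    intro i a hia
    rw [mul_assoc]
    gcongr
  rcases lt_or_ge k M with hkM | hkM
  · have h1 := hunroll 0 k
    rw [zero_add, hΛ0] at h1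
    have h2 : 0 ≤ ∑ l ∈ Finset.range k, wsq T⁻¹ (regOut (regressor f (x (0 + l)) (u (0 + l))) z) :=
      Finset.sum_nonneg fun _ _ => wsq_nonneg hT.inv _
    calc lam ^ M * min c₀ (cT * (α / 4)) * ‖z‖ ^ 2 ≤ lam ^ M * (c₀ * ‖z‖ ^ 2) :=
          hpow (min_le_left _ _)
      _ ≤ lam ^ k * (c₀ * ‖z‖ ^ 2) :=
          mul_le_mul_of_nonneg_right (pow_le_pow_of_le_one hlam0.le hlam1.le hkM.le)
            (by positivity)
      _ ≤ _ := by
          refine le_trans ?_ h1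
          gcongr
          linarith [(h₀b z).1]
  · obtain ⟨j, rfl⟩ : ∃ j, k = j + M := ⟨k - M, by omega⟩
    refine le_trans ?_ (hunroll j M)
    refine (hpow (min_le_right _ _)).trans ?_
    have hterm : ∀ l ∈ Finset.range M,
        cT * (‖regOut (regressor f (xr (j + l)) (ur (j + l))) z‖ ^ 2 / 2 - δ ^ 2 * ‖z‖ ^ 2) ≤
          wsq T⁻¹ (regOut (regressor f (x (j + l)) (u (j + l))) z) := by
      intro l hl
      obtain ⟨hx, hu⟩ := hk (j + l) (by have := Finset.mem_range.1 hl; omega)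
      have h1 := hclose (j + l) _ _ hx hu z
      refine le_trans ?_ (hTb _).1
      gcongr
      set a := regOut (regressor f (xr (j + l)) (ur (j + l))) z
      set b := regOut (regressor f (x (j + l)) (u (j + l))) z
      have h2 : ‖a‖ ≤ ‖b‖ + ‖b - a‖ := by simpa using norm_sub_le b (b - a)
      have h3 : ‖b - a‖ ^ 2 ≤ (δ * ‖z‖) ^ 2 := by gcongr
      have h4 : ‖a‖ ^ 2 ≤ (‖b‖ + ‖b - a‖) ^ 2 := by gcongr
      nlinarith [sq_nonneg (‖b‖ - ‖b - a‖)]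
    have hsum := Finset.sum_le_sum hterm
    rw [← Finset.mul_sum, Finset.sum_sub_distrib, ← Finset.sum_div, Finset.sum_const,
      Finset.card_range, nsmul_eq_mul, ← mul_assoc (M : ℝ), hδsq] at hsum
    have h5 : cT * (α / 4 * ‖z‖ ^ 2) ≤ cT * ((∑ l ∈ Finset.range M,
        ‖regOut (regressor f (xr (j + l)) (ur (j + l))) z‖ ^ 2) / 2 - α / 4 * ‖z‖ ^ 2) := by
      gcongr
      linarith [hαb j z]
    gcongr
    linarith [wsq_nonneg (hΛpos j) z]

end Excitation

/-! ### The adaptive closed loop -/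

section ClosedLoop

variable {f₀ : Vec n → Vec m → Vec n} {f : Fin S → Vec n → Vec m → Vec n}
  {Q : Matrix (Fin n) (Fin n) ℝ} {R : Matrix (Fin m) (Fin m) ℝ}

/-- The information matrices along a trajectory `(x, u)`; `infoSeq k` is the inverse of the
covariance matrix that enters the update of the estimate at time `k`. -/
noncomputable def infoSeq (lam : ℝ) (T : Matrix (Fin n) (Fin n) ℝ) (Λ₀ : Matrix (Fin S) (Fin S) ℝ)
    (f : Fin S → Vec n → Vec m → Vec n) (x : ℕ → Vec n) (u : ℕ → Vec m) :
    ℕ → Matrix (Fin S) (Fin S) ℝ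
  | 0 => Λ₀
  | k + 1 => infoUpdate lam T (infoSeq lam T Λ₀ f x u k) (regressor f (x k) (u k))

lemma infoSeq_posDef {lam : ℝ} (hlam : 0 < lam) {T : Matrix (Fin n) (Fin n) ℝ} (hT : T.PosDef)
    {Λ₀ : Matrix (Fin S) (Fin S) ℝ} (hΛ₀ : Λ₀.PosDef) (x : ℕ → Vec n) (u : ℕ → Vec m) (k : ℕ) :
    (infoSeq lam T Λ₀ f x u k).PosDef := by
  induction k with
  | zero => exact hΛ₀
  | succ k ih => exact infoUpdate_posDef hlam hT ih _

lemma model_sub_eq_regOut (θ : Vec S) (x : Vec n) (u : Vec m) (w : Vec n) :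
    model f₀ f θ x u + w - f₀ x u = regOut (regressor f x u) θ + w := by
  rw [regOut_regressor, model]
  abel

section Estimate

variable {θ : Vec S} {xr : ℕ → Vec n} {ur : ℕ → Vec m} {M N : ℕ} {lam : ℝ}
  {T : Matrix (Fin n) (Fin n) ℝ} {Pinit : Matrix (Fin S) (Fin S) ℝ} {w x : ℕ → Vec n}
  {u : ℕ → Vec m} {θhat : ℕ → Vec S} {P : ℕ → Matrix (Fin S) (Fin S) ℝ}

lemma IsAdaptiveClosedLoop.cov_eq_infoSeq_inv
    (h : IsAdaptiveClosedLoop f₀ f θ Q R xr ur M N lam T Pinit w x u θhat P)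
    (hlam : 0 < lam) (hT : T.PosDef) (hP : Pinit.PosDef) (k : ℕ) :
    P k = (infoSeq lam T Pinit⁻¹ f x u k)⁻¹ := by
  induction k with
  | zero =>
    rw [h.cov_zero, infoSeq,
      Matrix.nonsing_inv_nonsing_inv _ ((Matrix.isUnit_iff_isUnit_det _).1 hP.isUnit)]
  | succ k ih =>
    rw [h.cov_succ, ih, rlsP_inv_eq hlam hT (infoSeq_posDef hlam hT hP.inv x u k), infoSeq]

lemma IsAdaptiveClosedLoop.wsq_error_le
    (h : IsAdaptiveClosedLoop f₀ f θ Q R xr ur M N lam T Pinit w x u θhat P)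
    (hlam0 : 0 < lam) (hlam1 : lam < 1) (hT : T.PosDef) (hP : Pinit.PosDef) {c : ℝ}
    (hw : ∀ k, wsq T⁻¹ (w k) ≤ c) (k : ℕ) :
    wsq (infoSeq lam T Pinit⁻¹ f x u k) (θ - θhat k) ≤
      lam ^ k * wsq Pinit⁻¹ (θ - θhat 0) + c / (1 - lam) := by
  have h1 : 0 < 1 - lam := by linarith
  have hc : 0 ≤ c := (wsq_nonneg hT.inv _).trans (hw 0)
  induction k with
  | zero =>
    have : 0 ≤ c / (1 - lam) := by positivity
    simpa [infoSeq] using this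
  | succ k ih =>
    have hΛ := infoSeq_posDef (f := f) hlam0 hT hP.inv x u k
    have hstep := AdaptiveMPC.wsq_error_le hlam0 hT hΛ (regressor f (x k) (u k)) θ (θhat k) (w k)
    rw [← h.cov_eq_infoSeq_inv hlam0 hT hP, ← model_sub_eq_regOut (f₀ := f₀), ← h.plant,
      ← h.estimate] at hstep
    have h2 := mul_le_mul_of_nonneg_left ih hlam0.le
    have h3 : lam * (c / (1 - lam)) + c = c / (1 - lam) := by field_simp; ring
    rw [infoSeq, pow_succ']
    linarith [hw k]

end Estimate

set_option maxHeartbeats 400000 in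
/-- The closed-loop bounds in squared form. The value function contracts up to the squared
parameter error, and the parameter error contracts as long as the trajectory stays close enough to
the reference to be excited; for small initial errors and disturbances the two facts keep each
other valid for all times. -/
lemma exists_closed_loop_bounds (hC2 : BasisC2 f₀ f) (hQ : Q.PosDef) (hR : R.PosDef) (θ : Vec S)
    {Z : Set (Vec n × Vec m)} (hstab : LocallyIncrementallyStabilizable (model f₀ f θ) Z) {M : ℕ}
    {xr : ℕ → Vec n} {ur : ℕ → Vec m} (href : IsFeasiblePeriodic (model f₀ f θ) M xr ur)
    (hPE : IsPE f M xr ur) (hZ : ∀ k, (xr k, ur k) ∈ Z) {lam : ℝ} (hlam0 : 0 < lam)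
    (hlam1 : lam < 1) {T : Matrix (Fin n) (Fin n) ℝ} (hT : T.PosDef)
    {Pinit : Matrix (Fin S) (Fin S) ℝ} (hP : Pinit.PosDef) :
    ∃ N₀ : ℕ, 0 < N₀ ∧ ∀ N, N₀ ≤ N → ∃ σ a b A ν : ℝ, 0 < σ ∧ 0 < a ∧ 0 < b ∧ 0 < A ∧
      lam ≤ ν ∧ ν < 1 ∧ ∀ wbar : ℝ, 0 < wbar → wbar ≤ σ →
        IsRobustlyInvariant (model f₀ f θ) Q R xr ur N wbar
          (ZRPI (model f₀ f θ) Q R xr ur N (2 * b * wbar ^ 2)) ∧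
        ∀ (w x : ℕ → Vec n) (u : ℕ → Vec m) (θhat : ℕ → Vec S)
          (P : ℕ → Matrix (Fin S) (Fin S) ℝ),
          IsAdaptiveClosedLoop f₀ f θ Q R xr ur M N lam T Pinit w x u θhat P →
          (∀ k, ‖w k‖ ≤ wbar) → ‖x 0 - xr 0‖ ≤ σ → ‖θ - θhat 0‖ ≤ σ →
          ∀ k, value (model f₀ f θ) Q R xr ur N (x k) k ≤ a * ν ^ k + b * wbar ^ 2 ∧
            ‖θ - θhat k‖ ^ 2 ≤ A * (lam ^ k * σ ^ 2 + wbar ^ 2) := by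
  obtain ⟨N₀, hN₀, hN₀c⟩ := exists_value_contraction hC2 hQ hR θ hstab href hZ
  obtain ⟨cQ, _, hcQ, _, hQb⟩ := exists_wsq_bounds hQ
  obtain ⟨_, CT, _, hCT, hTb⟩ := exists_wsq_bounds hT.inv
  obtain ⟨_, CP, _, hCP, hPb⟩ := exists_wsq_bounds hP.inv
  obtain ⟨r, p, hr, hp, hinfo⟩ :=
    exists_information_lower_bound hC2 href hPE hlam0 hlam1 hT hP.inv
  have hl : 0 < 1 - lam := by linarith
  refine ⟨N₀, hN₀, fun N hN => ?_⟩
  obtain ⟨v, d, η, C, hv, hd, hη0, hη1, hC, hinit, hcontr⟩ := hN₀c N hN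
  have hN0 : 0 < N := hN₀.trans_le hN
  have hη : 0 < 1 - η := by linarith
  -- The summand `(lam ^ M)⁻¹` of `A` covers the first `M` steps, where the MPC uses `θhat 0`.
  set A : ℝ := (lam ^ M)⁻¹ + CP / p + CT / (1 - lam) / p with hA
  have hA0 : 0 < A := by positivity
  set ν : ℝ := max ((1 + η) / 2) lam with hν
  have hνη : (1 - η) / 2 ≤ ν - η := by linarith [le_max_left ((1 + η) / 2) lam]
  have hν0 : 0 < ν - η := by linarith
  have hlν : lam ≤ ν := le_max_right _ _
  have hν1 : ν < 1 := max_lt (by linarith) hlam1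
  set a₀ : ℝ := C + C * A / (ν - η) with ha₀
  have ha₀0 : 0 < a₀ := by positivity
  set b : ℝ := C * (A + 1) / (1 - η) with hb
  have hb0 : 0 < b := by positivity
  have hbη : η * b + C * (A + 1) = b := by rw [hb]; field_simp; ring
  have hsmall : ∀ K t : ℝ, 0 < t → ∀ᶠ σ in 𝓝[>] (0 : ℝ), K * σ ^ 2 < t := fun K t ht => by
    have hc : Continuous fun σ : ℝ => K * σ ^ 2 := by fun_prop
    exact (hc.continuousAt.eventually_lt continuousAt_const (by simpa using ht)).filter_mono
      nhdsWithin_le_nhds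
  obtain ⟨σ, h1, h2, h3, h4, h5, h6, h7, hσ⟩ := ((hsmall (a₀ + b) v hv).and
    ((hsmall (a₀ + b) (cQ * r ^ 2) (by positivity)).and
    ((hsmall (C * (a₀ + b + 2 * A)) (r ^ 2) (by positivity)).and
    ((hsmall (2 * A) (d ^ 2) (by positivity)).and
    ((hsmall 1 (d ^ 2) (by positivity)).and
    ((hsmall 1 (1 ^ 2) (by positivity)).and
    ((hsmall (2 * b) v hv).and self_mem_nhdsWithin))))))).exists
  have hσ0 : 0 < σ := hσ
  have hσd : σ ≤ d := le_of_sq_le_sq (by linarith) hd.le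
  have hσ1 : σ ≤ 1 := le_of_sq_le_sq (by linarith) one_pos.le
  refine ⟨σ, a₀ * σ ^ 2, b, A, ν, hσ0, by positivity, hb0, hA0, hlν, hν1, fun wbar hw0 hwσ => ?_⟩
  have hwsq : wbar ^ 2 ≤ σ ^ 2 := by gcongr
  constructor
  · rintro k x u w ⟨x', hx', hV⟩ hmpc hw
    obtain rfl : x = x' := sub_left_injective hx'
    refine ⟨_, rfl, ?_⟩
    have hVv : value (model f₀ f θ) Q R xr ur N x k ≤ v := by
      have : 2 * b * wbar ^ 2 ≤ 2 * b * σ ^ 2 := by gcongr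
      linarith
    have h := (hcontr k x θ u w hVv (by simpa using hd.le) (hw.trans (hwσ.trans hσ1)) hmpc).1
    simp only [sub_self, norm_zero] at h
    have h8 : C * ‖w‖ ^ 2 ≤ C * wbar ^ 2 := by gcongr
    have h9 : η * value (model f₀ f θ) Q R xr ur N x k ≤ η * (2 * b * wbar ^ 2) := by gcongr
    have h10 : C ≤ C * (A + 1) := le_mul_of_one_le_right hC.le (by linarith only [hA0])
    have h11 : (η * b + C * (A + 1)) * wbar ^ 2 = b * wbar ^ 2 := by rw [hbη]
    have h12 : C * wbar ^ 2 ≤ C * (A + 1) * wbar ^ 2 := by gcongr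
    have h13 : 0 ≤ C * (A + 1) * wbar ^ 2 := by positivity
    linarith only [h, h8, h9, h11, h12, h13]
  intro w x u θhat P hcl hw hx0 hθ0
  have hlpow : ∀ k : ℕ, lam ^ k ≤ 1 := fun k => pow_le_one₀ hlam0.le hlam1.le
  have hνpow : ∀ k : ℕ, ν ^ k ≤ 1 := fun k => pow_le_one₀ (hlam0.le.trans hlν) hν1.le
  have hθ0sq : ‖θ - θhat 0‖ ^ 2 ≤ σ ^ 2 := by gcongr
  -- The estimate used by the MPC inherits the bound on the current estimate.
  have hused : ∀ k, ‖θ - θhat k‖ ^ 2 ≤ A * (lam ^ k * σ ^ 2 + wbar ^ 2) →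
      ‖θ - (if k < M then θhat 0 else θhat k)‖ ^ 2 ≤ A * (lam ^ k * σ ^ 2 + wbar ^ 2) := by
    intro k hk
    split_ifs with hkM
    · have h8 : 1 ≤ (lam ^ M)⁻¹ * lam ^ k := by
        rw [le_inv_mul_iff₀ (by positivity), mul_one]
        exact pow_le_pow_of_le_one hlam0.le hlam1.le hkM.le
      have h9 : (lam ^ M)⁻¹ ≤ A := by
        have : 0 ≤ CP / p + CT / (1 - lam) / p := by positivity
        linarith
      calc ‖θ - θhat 0‖ ^ 2 ≤ 1 * σ ^ 2 := by linarith
        _ ≤ (lam ^ M)⁻¹ * lam ^ k * σ ^ 2 := by gcongr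
        _ ≤ A * lam ^ k * σ ^ 2 := by gcongr
        _ ≤ _ := by
          have : 0 ≤ A * wbar ^ 2 := by positivity
          linarith
    · exact hk
  have hstep : ∀ k, value (model f₀ f θ) Q R xr ur N (x k) k ≤
        a₀ * σ ^ 2 * ν ^ k + b * wbar ^ 2 →
      ‖θ - θhat k‖ ^ 2 ≤ A * (lam ^ k * σ ^ 2 + wbar ^ 2) →
      value (model f₀ f θ) Q R xr ur N (x (k + 1)) (k + 1) ≤
        a₀ * σ ^ 2 * ν ^ (k + 1) + b * wbar ^ 2 ∧ ‖x k - xr k‖ ≤ r ∧ ‖u k - ur k‖ ≤ r := by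
    intro k hVk hθk
    have hθu := hused k hθk
    set e := ‖θ - (if k < M then θhat 0 else θhat k)‖ with he
    have hVσ : value (model f₀ f θ) Q R xr ur N (x k) k ≤ (a₀ + b) * σ ^ 2 := by
      have h8 : a₀ * σ ^ 2 * ν ^ k ≤ a₀ * σ ^ 2 * 1 := by gcongr; exact hνpow k
      have h9 : b * wbar ^ 2 ≤ b * σ ^ 2 := by gcongr
      linarith only [hVk, h8, h9]
    have heσ : e ^ 2 ≤ 2 * A * σ ^ 2 := by
      have h8 : A * (lam ^ k * σ ^ 2 + wbar ^ 2) ≤ A * (1 * σ ^ 2 + σ ^ 2) := by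
        gcongr; exact hlpow k
      linarith only [hθu, h8]
    have hed : e ≤ d := le_of_sq_le_sq (by linarith) hd.le
    obtain ⟨hV', hu'⟩ := hcontr k (x k) _ (u k) (w k) (by linarith) hed
      ((hw k).trans (hwσ.trans hσ1)) (hcl.control k)
    rw [← hcl.plant, ← he] at hV'
    rw [← he] at hu'
    refine ⟨?_, ?_, ?_⟩
    · have h8 : ‖w k‖ ^ 2 ≤ wbar ^ 2 := by gcongr; exact hw k
      have h9 : η * value (model f₀ f θ) Q R xr ur N (x k) k ≤
          η * (a₀ * σ ^ 2 * ν ^ k + b * wbar ^ 2) := by gcongr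
      have h10 : C * (e ^ 2 + ‖w k‖ ^ 2) ≤
          C * (A * (ν ^ k * σ ^ 2 + wbar ^ 2) + wbar ^ 2) := by
        gcongr
        refine hθu.trans ?_
        gcongr
      have h11 : (η * b + C * (A + 1)) * wbar ^ 2 = b * wbar ^ 2 := by rw [hbη]
      have h12 : C * A ≤ a₀ * (ν - η) := by
        have : a₀ * (ν - η) = C * (ν - η) + C * A := by
          rw [ha₀, add_mul, div_mul_cancel₀ _ hν0.ne']
        have := mul_pos hC hν0
        linarith
      have h13 : C * A * (ν ^ k * σ ^ 2) ≤ a₀ * (ν - η) * (ν ^ k * σ ^ 2) :=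
        mul_le_mul_of_nonneg_right h12
          (mul_nonneg (pow_nonneg (hlam0.le.trans hlν) _) (sq_nonneg _))
      rw [pow_succ ν k]
      linarith only [hV', h9, h10, h11, h13]
    · refine le_of_sq_le_sq (le_of_mul_le_mul_left ?_ hcQ) hr.le
      have := (hQb (x k - xr k)).1.trans
        (wsq_le_value (model f₀ f θ) xr ur hQ hR hN0 (x k) k)
      linarith
    · refine le_of_sq_le_sq (hu'.trans ?_) hr.le
      have h8 : C * (value (model f₀ f θ) Q R xr ur N (x k) k + e ^ 2) ≤
        C * ((a₀ + b) * σ ^ 2 + 2 * A * σ ^ 2) := by gcongr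
      linarith only [h8, h3]
  have hmain : ∀ k, (value (model f₀ f θ) Q R xr ur N (x k) k ≤
        a₀ * σ ^ 2 * ν ^ k + b * wbar ^ 2 ∧
      ‖θ - θhat k‖ ^ 2 ≤ A * (lam ^ k * σ ^ 2 + wbar ^ 2)) := by
    intro k
    induction k using Nat.strong_induction_on with
    | _ k ih =>
      constructor
      · cases k with
        | zero =>
          have h8 := hinit 0 (x 0) (hx0.trans hσd)
          have h9 : C * ‖x 0 - xr 0‖ ^ 2 ≤ C * σ ^ 2 := by gcongr
          have h10 : 0 ≤ C * A / (ν - η) * σ ^ 2 := by positivity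
          have h11 : 0 ≤ b * wbar ^ 2 := by positivity
          have h12 : a₀ * σ ^ 2 = C * σ ^ 2 + C * A / (ν - η) * σ ^ 2 := by rw [ha₀]; ring
          rw [pow_zero, mul_one]
          linarith only [h8, h9, h10, h11, h12]
        | succ j => exact (hstep j (ih j (by omega)).1 (ih j (by omega)).2).1
      · have hlow := hinfo x u (infoSeq lam T Pinit⁻¹ f x u) rfl
          (infoSeq_posDef hlam0 hT hP.inv x u) (fun _ => rfl) k
          (fun i hi => (hstep i (ih i hi).1 (ih i hi).2).2) (θ - θhat k)
        have hup := hcl.wsq_error_le hlam0 hlam1 hT hP (c := CT * wbar ^ 2) (fun k => by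
          refine (hTb _).2.trans ?_
          gcongr
          exact hw k) k
        have h8 : lam ^ k * wsq Pinit⁻¹ (θ - θhat 0) ≤ lam ^ k * (CP * σ ^ 2) := by
          gcongr
          refine (hPb _).2.trans ?_
          gcongr
        have h9 : ‖θ - θhat k‖ ^ 2 ≤
            (lam ^ k * (CP * σ ^ 2) + CT * wbar ^ 2 / (1 - lam)) / p := by
          rw [le_div_iff₀' hp]; linarith only [hlow, hup, h8]
        have h10 : (lam ^ k * (CP * σ ^ 2) + CT * wbar ^ 2 / (1 - lam)) / p =
            CP / p * (lam ^ k * σ ^ 2) + CT / (1 - lam) / p * wbar ^ 2 := by ring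
        have h11 : CP / p ≤ A := by
          have : 0 ≤ (lam ^ M)⁻¹ + CT / (1 - lam) / p := by positivity
          linarith only [hA, this]
        have h12 : CT / (1 - lam) / p ≤ A := by
          have : 0 ≤ (lam ^ M)⁻¹ + CP / p := by positivity
          linarith only [hA, this]
        rw [h10] at h9
        refine h9.trans ?_
        rw [mul_add]
        gcongr
  exact hmain

end ClosedLoop

end AdaptiveMPC

theorem mainTheorem1 {n m S : ℕ}
    (f₀ : AdaptiveMPC.Vec n → AdaptiveMPC.Vec m → AdaptiveMPC.Vec n)
    (f : Fin S → AdaptiveMPC.Vec n → AdaptiveMPC.Vec m → AdaptiveMPC.Vec n)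
    (θ : AdaptiveMPC.Vec S)
    (Q : Matrix (Fin n) (Fin n) ℝ) (R : Matrix (Fin m) (Fin m) ℝ)
    (hQ : Q.PosDef) (hR : R.PosDef)
    (lam : ℝ) (hlam0 : 0 < lam) (hlam1 : lam < 1)
    (T : Matrix (Fin n) (Fin n) ℝ) (hT : T.PosDef)
    (Pinit : Matrix (Fin S) (Fin S) ℝ) (hPinit : Pinit.PosDef)
    (hC2 : AdaptiveMPC.BasisC2 f₀ f)
    (Z : Set (AdaptiveMPC.Vec n × AdaptiveMPC.Vec m))
    (hstab : AdaptiveMPC.LocallyIncrementallyStabilizable (AdaptiveMPC.model f₀ f θ) Z)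
    (M : ℕ) (xr : ℕ → AdaptiveMPC.Vec n) (ur : ℕ → AdaptiveMPC.Vec m)
    (href : AdaptiveMPC.IsFeasiblePeriodic (AdaptiveMPC.model f₀ f θ) M xr ur)
    (hPE : AdaptiveMPC.IsPE f M xr ur)
    (hZ : ∀ k, (xr k, ur k) ∈ Z)
    (hHess : ∀ N : ℕ, 0 < N →
      AdaptiveMPC.PosDefHessian (AdaptiveMPC.model f₀ f θ) Q R xr ur N) :
    ∃ N₀ : ℕ, 0 < N₀ ∧ ∀ N : ℕ, N₀ ≤ N →
      ∃ (cx cθ wmax γ₂ C μ : ℝ) (VRPI : ℝ → ℝ),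
        0 < cx ∧ 0 < cθ ∧ 0 < wmax ∧ 0 < γ₂ ∧ 0 < C ∧ 0 < μ ∧ μ < 1 ∧
        AdaptiveMPC.IsClassK VRPI ∧
        ∀ wbar : ℝ, 0 < wbar → wbar ≤ wmax →
          AdaptiveMPC.IsRobustlyInvariant (AdaptiveMPC.model f₀ f θ) Q R xr ur N wbar
            (AdaptiveMPC.ZRPI (AdaptiveMPC.model f₀ f θ) Q R xr ur N (VRPI wbar)) ∧
          ∀ (w : ℕ → AdaptiveMPC.Vec n) (x : ℕ → AdaptiveMPC.Vec n)
            (u : ℕ → AdaptiveMPC.Vec m) (θhat : ℕ → AdaptiveMPC.Vec S)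
            (P : ℕ → Matrix (Fin S) (Fin S) ℝ),
            AdaptiveMPC.IsAdaptiveClosedLoop f₀ f θ Q R xr ur M N lam T Pinit w x u θhat P →
            (∀ k, ‖w k‖ ≤ wbar) → ‖x 0 - xr 0‖ ≤ cx → ‖θ - θhat 0‖ ≤ cθ →
            (∀ k, Metric.infDist (x k - xr k)
              (AdaptiveMPC.ZRPI (AdaptiveMPC.model f₀ f θ) Q R xr ur N (VRPI wbar) k)
                ≤ C * μ ^ k) ∧
            (∀ k, ‖θ - θhat k‖ ≤ γ₂ / (1 - √lam) * wbar + C * μ ^ k) := by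
  obtain ⟨N₀, hN₀, h⟩ := AdaptiveMPC.exists_closed_loop_bounds hC2 hQ hR θ hstab href hPE hZ
    hlam0 hlam1 hT hPinit
  obtain ⟨cQ, _, hcQ, _, hQb⟩ := AdaptiveMPC.exists_wsq_bounds hQ
  refine ⟨N₀, hN₀, fun N hN => ?_⟩
  obtain ⟨σ, a, b, A, ν, hσ, ha, hb, hA, hlν, hν1, hbounds⟩ := h N hN
  have hν0 : 0 < ν := hlam0.trans_le hlν
  have hs : 0 < 1 - √lam := sub_pos.2 ((Real.sqrt_lt' one_pos).2 (by simpa using hlam1))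
  refine ⟨σ, σ, σ, √A, √(2 * a / cQ) + √A * σ, √ν, fun w => 2 * b * w ^ 2, hσ, hσ, hσ,
    Real.sqrt_pos.2 hA, by positivity, Real.sqrt_pos.2 hν0,
    (Real.sqrt_lt' one_pos).2 (by simpa using hν1), ⟨by fun_prop, ?_, by simp⟩,
    fun wbar hw0 hwσ => ⟨(hbounds wbar hw0 hwσ).1, fun w x u θhat P hcl hw hx hθ => ⟨?_, ?_⟩⟩⟩
  · intro s hs0 t _ hst
    have hs0' : 0 ≤ s := hs0
    have : s ^ 2 < t ^ 2 := by gcongr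
    simp only
    gcongr
  · intro k
    have hV := ((hbounds wbar hw0 hwσ).2 w x u θhat P hcl hw hx hθ k).1
    have hval0 : AdaptiveMPC.value (AdaptiveMPC.model f₀ f θ) Q R xr ur N (xr k) k ≤
        2 * b * wbar ^ 2 := by
      have htraj : ∀ i, AdaptiveMPC.traj (AdaptiveMPC.model f₀ f θ) (xr k)
          (fun j => ur (k + j)) i = xr (k + i) := by
        intro i
        induction i with
        | zero => rfl
        | succ i ih => rw [AdaptiveMPC.traj, ih, ← href.dynamics, add_assoc]
      refine (AdaptiveMPC.value_le_seqCost _ xr ur hQ hR N (xr k) k fun j => ur (k + j)).trans ?_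
      have : 0 ≤ 2 * b * wbar ^ 2 := by positivity
      simpa [AdaptiveMPC.seqCost, AdaptiveMPC.stage, htraj, AdaptiveMPC.wsq_zero] using this
    by_cases hmem : AdaptiveMPC.value (AdaptiveMPC.model f₀ f θ) Q R xr ur N (x k) k ≤
        2 * b * wbar ^ 2
    · have hz : x k - xr k ∈ AdaptiveMPC.ZRPI (AdaptiveMPC.model f₀ f θ) Q R xr ur N
          (2 * b * wbar ^ 2) k := ⟨x k, rfl, hmem⟩
      exact (Metric.infDist_zero_of_mem hz).trans_le (by positivity)
    -- Outside the invariant set the transient dominates, and `0` lies in the set.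
    · have hz : (0 : AdaptiveMPC.Vec n) ∈ AdaptiveMPC.ZRPI (AdaptiveMPC.model f₀ f θ) Q R xr ur N
          (2 * b * wbar ^ 2) k := ⟨xr k, by simp, hval0⟩
      refine (Metric.infDist_le_dist_of_mem hz).trans ?_
      rw [dist_zero_right]
      have h1 := (hQb (x k - xr k)).1.trans (AdaptiveMPC.wsq_le_value
        (AdaptiveMPC.model f₀ f θ) xr ur hQ hR (hN₀.trans_le hN) (x k) k)
      have h2 : ‖x k - xr k‖ ^ 2 ≤ 2 * a / cQ * ν ^ k := by
        rw [div_mul_eq_mul_div, le_div_iff₀' hcQ]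
        linarith
      have h3 : ‖x k - xr k‖ ≤ √(2 * a / cQ) * √ν ^ k := by
        refine le_of_sq_le_sq (h2.trans_eq ?_) (by positivity)
        rw [mul_pow, ← pow_mul, mul_comm k 2, pow_mul, Real.sq_sqrt (by positivity),
          Real.sq_sqrt hν0.le]
      refine h3.trans ?_
      gcongr
      linarith [mul_pos (Real.sqrt_pos.2 hA) hσ]
  · intro k
    have h1 := ((hbounds wbar hw0 hwσ).2 w x u θhat P hcl hw hx hθ k).2
    have h2 : ‖θ - θhat k‖ ≤ √A * (√lam ^ k * σ + wbar) := by
      refine le_of_sq_le_sq (h1.trans ?_) (by positivity)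
      rw [mul_pow, Real.sq_sqrt hA.le]
      gcongr
      have h3 : (√lam ^ k) ^ 2 = lam ^ k := by
        rw [← pow_mul, mul_comm k 2, pow_mul, Real.sq_sqrt hlam0.le]
      have h4 : 0 ≤ √lam ^ k * σ * wbar := by positivity
      rw [add_sq, mul_pow, h3]
      linarith
    have h5 : √A * wbar ≤ √A / (1 - √lam) * wbar := by
      gcongr
      rw [le_div_iff₀ hs]
      exact mul_le_of_le_one_right (Real.sqrt_nonneg _) (by linarith [Real.sqrt_nonneg lam])
    have h6 : √A * (√lam ^ k * σ) ≤ (√(2 * a / cQ) + √A * σ) * √ν ^ k := by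
      have h7 : √lam ^ k ≤ √ν ^ k := by gcongr
      have h8 : 0 ≤ √(2 * a / cQ) * √ν ^ k := by positivity
      have h9 : √A * σ * √lam ^ k ≤ √A * σ * √ν ^ k := by gcongr
      linarith
    linarith
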